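/- **Conventions.** Let $M$ be a smooth manifold (finite-dimensional, Hausdorff) with a 2-plectic form $\omega$, i.e. a closed 3-form such that $\iota_u\omega=0$ with $u\in T_xM$ implies $u=0$. For vector fields $X,Y$ and bivector fields $v$ put $(\iota_X a)(\cdot)=a(X,\cdot)$, $\iota_{X\wedge Y}=\iota_Y\iota_X$, $\iota_{v\wedge X}=\iota_X\iota_v$; $[\cdot,\cdot]$ is the Schouten bracket, so $[X,Y\wedge Z]=[X,Y]\wedge Z+Y\wedge[X,Z]$ and $[v,X]=-[X,v]$. A *Lie 2-algebra* is a real vector space $\mathfrak g=\mathfrak g_{-1}\oplus\mathfrak g_0$ with a linear map $l_1:\mathfrak g_{-1}\to\mathfrak g_0$, a bilinear bracket $l_2$ that is skew on $\mathfrak g_0\times\mathfrak g_0$ with values in $\mathfrak g_0$, and with values in $\mathfrak g_{-1}$ and $l_2(x,a)=-l_2(a,x)$ for $a\in\mathfrak g_{-1}$, $x\in\mathfrak g_0$, and an alternating trilinear map $l_3:\mathfrak g_0^3\to\mathfrak g_{-1}$ such that, for $x,y,z,t\in\mathfrak g_0$ and $a,b\in\mathfrak g_{-1}$: * $l_1l_2(x,a)=l_2(x,l_1a)$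 and $l_2(l_1a,b)=l_2(a,l_1b)$; * $l_1l_3(x,y,z)=-l_2(l_2(x,y),z)-l_2(l_2(y,z),x)-l_2(l_2(z,x),y)$; * $l_3(l_1a,x,y)=l_2(a,l_2(x,y))+l_2(l_2(a,y),x)-l_2(l_2(a,x),y)$; * $l_3(l_2(x,y),z,t)-l_3(l_2(x,z),y,t)+l_3(l_2(x,t),y,z)+l_3(l_2(y,z),x,t)-l_3(l_2(y,t),x,z)+l_3(l_2(z,t),x,y)=l_2(l_3(x,y,z),t)-l_2(l_3(x,y,t),z)+l_2(l_3(x,z,t),y)-l_2(l_3(y,z,t),x)$. A *morphism* $F:\mathfrak g\to\mathfrak g'$ consists of linear maps $F_{1,0}:\mathfrak g_0\to\mathfrak g_0'$, $F_{1,-1}:\mathfrak g_{-1}\to\mathfrak g'_{-1}$ and an alternating bilinear map $F_2:\mathfrak g_0^2\to\mathfrak g_{-1}'$ such that * $l_1'F_{1,-1}(a)=F_{1,0}(l_1a)$ and $l_1'F_2(x,y)=F_{1,0}(l_2(x,y))-l_2'(F_{1,0}x,F_{1,0}y)$; * $F_{1,-1}(l_2(a,x))=F_2(l_1a,x)+l_2'(F_{1,-1}a,F_{1,0}x)$;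 * $F_{1,-1}(l_3(x,y,z))+\sum_{\rm cyc}F_2(l_2(x,y),z)=l_3'(F_{1,0}x,F_{1,0}y,F_{1,0}z)+\sum_{\rm cyc}l_2'(F_{1,0}x,F_2(y,z))$, with cyclic sums over $(x,y,z)$. It is *strict* if $F_2=0$. The composite $G\circ F$ has components $G_{1,0}F_{1,0}$, $G_{1,-1}F_{1,-1}$ and $(G\circ F)_2(x,y)=G_2(F_{1,0}x,F_{1,0}y)+G_{1,-1}F_2(x,y)$. **The Lie 2-algebras on $M$.** A 1-form $\alpha$ is in $\Omega^1_{Ham}(M)$ if $d\alpha=-\iota_{X_\alpha}\omega$ for a (unique) vector field $X_\alpha$; a vector field of the form $X_\alpha$ is called Hamiltonian. A pair $(f,v)$ of a smooth function and a bivector field is in $Ham^0(M)$ if $df=-\iota_v\omega$. * $\mathfrak X^2(M)\oplus\mathfrak X^1(M)$: bivector fields in degree $-1$, vector fields in degree $0$; $l_1=0$, $l_3=0$, and $l_2$ is the Schouten bracket. * $\mathsf{L^2(M,\omega)}=C^\infty(M)\oplus\Omega^1_{Ham}(M)$: $l_1(f)=df$, $l_2(\alpha,\beta)=\iota_{X_\alpha\wedge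 X_\beta}\omega$, $l_2(f,\alpha)=0$, $l_3(\alpha,\beta,\gamma)=-\omega(X_\alpha,X_\beta,X_\gamma)$. * $\mathsf{\widetilde{D^2(M,\omega)}}=(C^\infty(M)\times Ham^0(M))\oplus\Omega^1_{Ham}(M)$: $l_1(f',(f,v))=df'$, $l_2(\alpha,\beta)=\iota_{X_\alpha\wedge X_\beta}\omega$, $l_2((f',(f,v)),\alpha)=(0,(\iota_{v\wedge X_\alpha}\omega,[v,X_\alpha]))$, $l_3(\alpha,\beta,\gamma)=(-\omega(X_\alpha,X_\beta,X_\gamma),(0,0))$. There are strict morphisms $I:\mathsf{L^2(M,\omega)}\to\mathsf{\widetilde{D^2(M,\omega)}}$ with $I_{1,0}=\mathrm{id}$, $I_{1,-1}(f')=(f',(0,0))$; $\Phi:\mathsf{\widetilde{D^2(M,\omega)}}\to\mathsf{L^2(M,\omega)}$ with $\Phi_{1,0}=\mathrm{id}$, $\Phi_{1,-1}(f',(f,v))=f'$; and $\Psi:\mathsf{\widetilde{D^2(M,\omega)}}\to\mathfrak X^2(M)\oplus\mathfrak X^1(M)$ with $\Psi_{1,0}(\alpha)=X_\alpha$, $\Psi_{1,-1}(f',(f,v))=v$.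 **Actions and comomentum maps.** Let $\mathfrak g=\mathfrak g_{-1}\oplus\mathfrak g_0$ be a real Lie 2-algebra (of any dimension) such that $(\mathfrak g_0,l_2)$ is a Lie algebra. * A *2-action* of $\mathfrak g$ on $M$ is a morphism $\rho:\mathfrak g\to\mathfrak X^2(M)\oplus\mathfrak X^1(M)$. A *2-comomentum map* for $\rho$ along $\Psi$ is a morphism $\lambda:\mathfrak g\to\mathsf{\widetilde{D^2(M,\omega)}}$ with $\Psi\circ\lambda=\rho$. * An *infinitesimal action of $\mathfrak g_0$ by Hamiltonian vector fields* is a linear map $\rho^{\mathfrak g_0}:\mathfrak g_0\to\mathfrak X^1(M)$ whose values are Hamiltonian and which satisfies $\rho^{\mathfrak g_0}(l_2(x,y))=[\rho^{\mathfrak g_0}(x),\rho^{\mathfrak g_0}(y)]$. A *homotopy comomentum map* for it is a morphism $\lambda^{\mathfrak g}:\mathfrak g\to\mathsf{L^2(M,\omega)}$ with $d(\lambda^{\mathfrak g}_{1,0}(x))=-\iota_{\rho^{\mathfrak g_0}(x)}\omega$ for all $x\in\mathfrak g_0$. **Theorem.** 1. Let $\lambda^{\mathfrak g}$ be a homotopy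 comomentum map for an infinitesimal action $\rho^{\mathfrak g_0}$ of $\mathfrak g_0$ by Hamiltonian vector fields. Then $\rho=(\rho_{1,0},\rho_{1,-1},\rho_2)=(\rho^{\mathfrak g_0},0,0)$ is a 2-action, and $I\circ\lambda^{\mathfrak g}$ is a 2-comomentum map for $\rho$ along $\Psi$. 2. Conversely, let $\rho$ be a 2-action with $\rho_{1,-1}=0$ and $\rho_2=0$, and let $\lambda$ be a 2-comomentum map for $\rho$ along $\Psi$. Then $\rho_{1,0}$ is an infinitesimal action of $\mathfrak g_0$ by Hamiltonian vector fields, and $\Phi\circ\lambda$ is a homotopy comomentum map for it. -/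

import Mathlib

open scoped Manifold ContDiff Topology
set_option linter.unusedSectionVars false
set_option maxSynthPendingDepth 3

noncomputable section

namespace Plectic

section

variable {E : Type*} [NormedAddCommGroup E] [NormedSpace ℝ E] [FiniteDimensional ℝ E]
  {M : Type*} [TopologicalSpace M] [ChartedSpace E M] [IsManifold 𝓘(ℝ, E) ∞ M]

/-- The differential at `y` of the chart centred at `x₀`. Mathlib's tangent space at `y` is a copy
of the model space `E`, identified with `E` through the preferred chart at `y`. -/
def dChart (x₀ y : M) : E →L[ℝ] E := mfderiv 𝓘(ℝ, E) 𝓘(ℝ, E) (extChartAt 𝓘(ℝ, E) x₀) y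
/-- The differential at `u` of the inverse of the chart centred at `x₀`. -/
def dChartSymm (x₀ : M) (u : E) : E →L[ℝ] E :=
  mfderiv 𝓘(ℝ, E) 𝓘(ℝ, E) (extChartAt 𝓘(ℝ, E) x₀).symm u

lemma dChart_comp_symm {x₀ : M} {u : E} (hu : u ∈ (extChartAt 𝓘(ℝ, E) x₀).target) (v : E) :
    dChart x₀ ((extChartAt 𝓘(ℝ, E) x₀).symm u) (dChartSymm x₀ u v) = v := by
  have := mfderiv_extChartAt_comp_mfderivWithin_extChartAt_symm (I := 𝓘(ℝ, E)) hu
  rw [modelWithCornersSelf_coe, Set.range_id, mfderivWithin_univ] at this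
  exact congrArg (fun f : E →L[ℝ] E => f v) this

lemma dChartSymm_comp {x₀ : M} {u : E} (hu : u ∈ (extChartAt 𝓘(ℝ, E) x₀).target) (v : E) :
    dChartSymm x₀ u (dChart x₀ ((extChartAt 𝓘(ℝ, E) x₀).symm u) v) = v := by
  have := mfderivWithin_extChartAt_symm_comp_mfderiv_extChartAt (I := 𝓘(ℝ, E)) hu
  rw [modelWithCornersSelf_coe, Set.range_id, mfderivWithin_univ] at this
  exact congrArg (fun f : E →L[ℝ] E => f v) this

lemma dChart_self (x₀ : M) : dChart x₀ x₀ = ContinuousLinearMap.id ℝ E :=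
  mfderiv_extChartAt_self (I := 𝓘(ℝ, E))

lemma dChartSymm_self (x₀ : M) : dChartSymm x₀ (extChartAt 𝓘(ℝ, E) x₀ x₀)
    = ContinuousLinearMap.id ℝ E := by
  have := mfderivWithin_range_extChartAt_symm (I := 𝓘(ℝ, E)) (x := x₀)
  rw [modelWithCornersSelf_coe, Set.range_id, mfderivWithin_univ] at this
  exact this

/-- Smooth vector fields on `M`. -/
abbrev VF (E : Type*) [NormedAddCommGroup E] [NormedSpace ℝ E] (M : Type*) [TopologicalSpace M]
  [ChartedSpace E M] [IsManifold 𝓘(ℝ, E) ∞ M] :=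
  Cₛ^∞⟮𝓘(ℝ, E); E, (fun x : M => TangentSpace 𝓘(ℝ, E) x)⟯

/-- The coordinate expression of a vector field in the chart centred at `x₀`. -/
def vecRep (X : VF E M) (x₀ : M) (u : E) : E :=
  dChart x₀ ((extChartAt 𝓘(ℝ, E) x₀).symm u) (X ((extChartAt 𝓘(ℝ, E) x₀).symm u))

/-- The coordinate expression of a differential form in the chart centred at `x₀`. -/
def altRep {k : ℕ} (a : M → E [⋀^Fin k]→L[ℝ] ℝ) (x₀ : M) (u : E) : E [⋀^Fin k]→L[ℝ] ℝ :=
  (a ((extChartAt 𝓘(ℝ, E) x₀).symm u)).compContinuousLinearMap (dChartSymm x₀ u)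

lemma vecRep_eq_mpullback (X : VF E M) (x₀ : M) (u : E) (hu : u ∈ (extChartAt 𝓘(ℝ, E) x₀).target) :
    vecRep X x₀ u =
    VectorField.mpullback 𝓘(ℝ, E) 𝓘(ℝ, E) (extChartAt 𝓘(ℝ, E) x₀).symm X u := by
  rw [VectorField.mpullback_apply]
  have h1 : (dChartSymm x₀ u).inverse = dChart x₀ ((extChartAt 𝓘(ℝ, E) x₀).symm u) := by
    apply ContinuousLinearMap.inverse_eq
    · ext v; exact dChartSymm_comp hu v
    · ext v; exact dChart_comp_symm hu v
  exact congrArg (fun f : E →L[ℝ] E => f (X ((extChartAt 𝓘(ℝ, E) x₀).symm u))) h1.symm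

lemma isOpen_tgt (x₀ : M) : IsOpen (extChartAt 𝓘(ℝ, E) x₀).target := isOpen_extChartAt_target x₀

lemma vecRep_smooth (X : VF E M) (x₀ : M) :
    ContDiffOn ℝ ∞ (vecRep X x₀) (extChartAt 𝓘(ℝ, E) x₀).target := by
  refine ContDiffOn.congr ?_ (fun u hu => vecRep_eq_mpullback X x₀ u hu)
  rw [← contMDiffOn_vectorSpace_iff_contDiffOn]
  intro u hu
  have := isInvertible_mfderivWithin_extChartAt_symm (I := 𝓘(ℝ, E)) hu
  rw [modelWithCornersSelf_coe, Set.range_id, mfderivWithin_univ] at this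
  apply ContMDiffAt.contMDiffWithinAt
  refine ContMDiffAt.mpullback_vectorField_preimage (n := ∞) ?_ ?_ this (by simp)
  · exact X.contMDiff _
  · exact (contMDiffOn_extChartAt_symm (n := ∞) x₀).contMDiffAt ((isOpen_tgt x₀).mem_nhds hu)

lemma two_le : (2 : WithTop ℕ∞) ≤ ∞ := WithTop.coe_le_coe.2 (le_top : (2 : ℕ∞) ≤ ⊤)

lemma tgt_nhds (x₀ : M) : (extChartAt 𝓘(ℝ, E) x₀).target ∈ 𝓝 (extChartAt 𝓘(ℝ, E) x₀ x₀) :=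
  extChartAt_target_mem_nhds x₀

lemma rep_smooth {f : M → ℝ} (hf : ContMDiff 𝓘(ℝ, E) 𝓘(ℝ, ℝ) ∞ f) (x₀ : M) :
    ContDiffOn ℝ ∞ (f ∘ (extChartAt 𝓘(ℝ, E) x₀).symm) (extChartAt 𝓘(ℝ, E) x₀).target :=
  contMDiffOn_iff_contDiffOn.1 (hf.comp_contMDiffOn (contMDiffOn_extChartAt_symm x₀))

lemma smooth_of_rep {f : M → ℝ} (hf : ∀ x₀ : M, ContDiffOn ℝ ∞
    (f ∘ (extChartAt 𝓘(ℝ, E) x₀).symm) (extChartAt 𝓘(ℝ, E) x₀).target) :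
    ContMDiff 𝓘(ℝ, E) 𝓘(ℝ, ℝ) ∞ f := by
  intro x₀
  have h1 : ContMDiffOn 𝓘(ℝ, E) 𝓘(ℝ, ℝ) ∞
      ((f ∘ (extChartAt 𝓘(ℝ, E) x₀).symm) ∘ extChartAt 𝓘(ℝ, E) x₀) (chartAt E x₀).source :=
    (contMDiffOn_iff_contDiffOn.2 (hf x₀)).comp contMDiffOn_extChartAt
      (fun y hy => (extChartAt 𝓘(ℝ, E) x₀).map_source (by simpa using hy))
  have h2 := h1.contMDiffAt ((chartAt E x₀).open_source.mem_nhds (mem_chart_source E x₀))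
  refine h2.congr_of_eventuallyEq ?_
  filter_upwards [extChartAt_source_mem_nhds (I := 𝓘(ℝ, E)) x₀] with y hy
  exact congrArg f ((extChartAt 𝓘(ℝ, E) x₀).left_inv hy).symm

/-- The differential of a function at a point, as a covector. -/
def dAt (f : M → ℝ) (x : M) : E →L[ℝ] ℝ := mfderiv 𝓘(ℝ, E) 𝓘(ℝ, ℝ) f x

lemma fderiv_rep {f : M → ℝ} (hf : ContMDiff 𝓘(ℝ, E) 𝓘(ℝ, ℝ) ∞ f) {x₀ : M} {u : E}
    (hu : u ∈ (extChartAt 𝓘(ℝ, E) x₀).target) :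
    fderiv ℝ (f ∘ (extChartAt 𝓘(ℝ, E) x₀).symm) u =
      (dAt (E := E) f ((extChartAt 𝓘(ℝ, E) x₀).symm u)).comp (dChartSymm x₀ u) := by
  rw [← mfderiv_eq_fderiv, mfderiv_comp u (I' := 𝓘(ℝ, E))]
  · rfl
  · exact hf.mdifferentiableAt (by simp)
  · exact ((contMDiffOn_extChartAt_symm (n := ∞) x₀).contMDiffAt
      ((isOpen_tgt x₀).mem_nhds hu)).mdifferentiableAt (by simp)

lemma dChartSymm_vecRep (X : VF E M) {x₀ : M} {u : E}
    (hu : u ∈ (extChartAt 𝓘(ℝ, E) x₀).target) :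
    dChartSymm x₀ u (vecRep X x₀ u) = X ((extChartAt 𝓘(ℝ, E) x₀).symm u) :=
  dChartSymm_comp hu _

lemma vecRep_self (X : VF E M) (x₀ : M) : vecRep X x₀ (extChartAt 𝓘(ℝ, E) x₀ x₀) = X x₀ := by
  have h : (extChartAt 𝓘(ℝ, E) x₀).symm (extChartAt 𝓘(ℝ, E) x₀ x₀) = x₀ := extChartAt_to_inv x₀
  unfold vecRep
  rw [h, dChart_self]; rfl

/-- The derivative `X f` of a function along a vector field. -/
def lieD (X : VF E M) (f : M → ℝ) (x : M) : ℝ := dAt (E := E) f x (X x)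

lemma lieD_rep (X : VF E M) {f : M → ℝ} (hf : ContMDiff 𝓘(ℝ, E) 𝓘(ℝ, ℝ) ∞ f) {x₀ : M} {u : E}
    (hu : u ∈ (extChartAt 𝓘(ℝ, E) x₀).target) :
    lieD X f ((extChartAt 𝓘(ℝ, E) x₀).symm u) =
      fderiv ℝ (f ∘ (extChartAt 𝓘(ℝ, E) x₀).symm) u (vecRep X x₀ u) := by
  rw [fderiv_rep hf hu, ContinuousLinearMap.comp_apply, dChartSymm_vecRep X hu]; rfl

lemma lieD_self (X : VF E M) {f : M → ℝ} (hf : ContMDiff 𝓘(ℝ, E) 𝓘(ℝ, ℝ) ∞ f) (x₀ : M)  :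
    lieD X f x₀ =
      fderiv ℝ (f ∘ (extChartAt 𝓘(ℝ, E) x₀).symm) (extChartAt 𝓘(ℝ, E) x₀ x₀) (X x₀) := by
  have := lieD_rep X hf (mem_extChartAt_target (I := 𝓘(ℝ, E)) x₀)
  rwa [extChartAt_to_inv x₀, vecRep_self] at this

lemma lieD_smooth (X : VF E M) {f : M → ℝ} (hf : ContMDiff 𝓘(ℝ, E) 𝓘(ℝ, ℝ) ∞ f) :
    ContMDiff 𝓘(ℝ, E) 𝓘(ℝ, ℝ) ∞ (lieD X f) := by
  refine smooth_of_rep fun x₀ => ?_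
  refine ContDiffOn.congr ?_ (fun u hu => lieD_rep X hf hu)
  exact ((rep_smooth hf x₀).fderiv_of_isOpen (isOpen_tgt x₀) (by simp)).clm_apply (vecRep_smooth X x₀)

/-- The Lie bracket of vector fields. -/
def bracket (X Y : VF E M) : VF E M where
  toFun x := VectorField.mlieBracket 𝓘(ℝ, E) X Y x
  contMDiff_toFun := by
    have : IsManifold 𝓘(ℝ, E) (minSmoothness ℝ 2) M := IsManifold.of_le (n := ∞) (by simpa using two_le)
    have : IsManifold 𝓘(ℝ, E) (((⊤ : ℕ∞) : WithTop ℕ∞) + 1) M := by simpa using ‹IsManifold 𝓘(ℝ, E) ∞ M›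
    exact ContDiff.mlieBracket_vectorField (m := ⊤) (n := ⊤) X.contMDiff Y.contMDiff (by simp)

lemma diffAt_vecRep (X : VF E M) (x₀ : M) :
    DifferentiableAt ℝ (vecRep X x₀) (extChartAt 𝓘(ℝ, E) x₀ x₀) :=
  ((vecRep_smooth X x₀).contDiffAt (tgt_nhds x₀)).differentiableAt (by simp)

lemma diffAt_rep {f : M → ℝ} (hf : ContMDiff 𝓘(ℝ, E) 𝓘(ℝ, ℝ) ∞ f) (x₀ : M) :
    DifferentiableAt ℝ (f ∘ (extChartAt 𝓘(ℝ, E) x₀).symm) (extChartAt 𝓘(ℝ, E) x₀ x₀) :=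
  ((rep_smooth hf x₀).contDiffAt (tgt_nhds x₀)).differentiableAt (by simp)

lemma aux_inv (V W : E → E) (u : E) : (ContinuousLinearMap.id ℝ E).inverse
    (VectorField.lieBracketWithin ℝ V W Set.univ u) = VectorField.lieBracket ℝ V W u := by
  simp

lemma bracket_self_pt (X Y : VF E M) (x₀ : M) :
    bracket X Y x₀ = VectorField.lieBracket ℝ (vecRep X x₀) (vecRep Y x₀)
      (extChartAt 𝓘(ℝ, E) x₀ x₀) := by
  change VectorField.mlieBracket 𝓘(ℝ, E) X Y x₀ = _
  rw [← VectorField.mlieBracketWithin_univ, VectorField.mlieBracketWithin_apply]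
  rw [modelWithCornersSelf_coe, Set.range_id, Set.preimage_univ, Set.univ_inter]
  change (dChart x₀ x₀).inverse (VectorField.lieBracketWithin ℝ (E := E)
    (VectorField.mpullbackWithin 𝓘(ℝ, E) 𝓘(ℝ, E) (extChartAt 𝓘(ℝ, E) x₀).symm X Set.univ)
    (VectorField.mpullbackWithin 𝓘(ℝ, E) 𝓘(ℝ, E) (extChartAt 𝓘(ℝ, E) x₀).symm Y Set.univ)
     Set.univ (extChartAt 𝓘(ℝ, E) x₀ x₀)) = _
  rw [dChart_self]
  refine (aux_inv _ _ _).trans ?_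
  simp only [VectorField.mpullbackWithin_univ]
  have h : ∀ X : VF E M, vecRep X x₀ =ᶠ[𝓝 (extChartAt 𝓘(ℝ, E) x₀ x₀)]
     VectorField.mpullback 𝓘(ℝ, E) 𝓘(ℝ, E) (extChartAt 𝓘(ℝ, E) x₀).symm X := fun X => by
    filter_upwards [tgt_nhds x₀] with u hu using vecRep_eq_mpullback X x₀ u hu
  exact ((h X).lieBracket_vectorField_eq (h Y)).symm

lemma lieD_bracket (X Y : VF E M) {f : M → ℝ} (hf : ContMDiff 𝓘(ℝ, E) 𝓘(ℝ, ℝ) ∞ f) (x₀ : M) :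
    lieD (bracket X Y) f x₀ = lieD X (lieD Y f) x₀ - lieD Y (lieD X f) x₀ := by
  rw [lieD_self _ hf, lieD_self _ (lieD_smooth Y hf), lieD_self _ (lieD_smooth X hf), bracket_self_pt]
  have h := VectorField.fderiv_apply_lieBracket (𝕜 := ℝ) (n := ∞) ((rep_smooth hf x₀).contDiffAt (tgt_nhds x₀)) (by simpa using two_le)
    (diffAt_vecRep Y x₀) (diffAt_vecRep X x₀)
  have e : ∀ Z : VF E M, (lieD Z f ∘ (extChartAt 𝓘(ℝ, E) x₀).symm) =ᶠ[𝓝 (extChartAt 𝓘(ℝ, E) x₀ x₀)]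
     fun u => fderiv ℝ (f ∘ (extChartAt 𝓘(ℝ, E) x₀).symm) u (vecRep Z x₀ u) := fun Z => by
    filter_upwards [tgt_nhds x₀] with u hu using lieD_rep Z hf hu
  rw [(e X).fderiv_eq, (e Y).fderiv_eq, h, vecRep_self, vecRep_self]

lemma exists_bump [T2Space M] (x : M) {s : Set M} (hs : s ∈ 𝓝 x) : ∃ ψ : M → ℝ,
    ContMDiff 𝓘(ℝ, E) 𝓘(ℝ, ℝ) ∞ ψ ∧ ψ =ᶠ[𝓝 x] 1 ∧ tsupport ψ ⊆ s := by
  obtain ⟨f, -, hf⟩ := (SmoothBumpFunction.nhds_basis_tsupport (I := 𝓘(ℝ, E)) (c := x)).mem_iff.1 hs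
  exact ⟨f, f.contMDiff, f.eventuallyEq_one, hf⟩

lemma exists_VF [T2Space M] (x : M) (v : E) : ∃ X : VF E M, X x = v := by
  obtain ⟨s, hs, h⟩ := FiberBundle.exists_contMDiffOn_extend 𝓘(ℝ, E) (k := ∞) (F := E)
    (V := (TangentSpace 𝓘(ℝ, E) : M → Type _)) (x₀ := x) v
  obtain ⟨ψ, h1, h2, h3⟩ := exists_bump (E := E) x (interior_mem_nhds.2 hs)
  refine ⟨⟨ψ • FiberBundle.extend E v, ContMDiffOn.smul_section_of_tsupport h1.contMDiffOn isOpen_interior h3 (h.mono interior_subset)⟩, ?_⟩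
  have h4 : (FiberBundle.extend E (E := (TangentSpace 𝓘(ℝ, E) : M → Type _)) (x := x) v x) = v :=
    FiberBundle.extend_apply_self (F := E) (E := (TangentSpace 𝓘(ℝ, E) : M → Type _)) (x := x) v
  have h5 : ψ x = 1 := h2.self_of_nhds
  change ψ x • (FiberBundle.extend E (E := (TangentSpace 𝓘(ℝ, E) : M → Type _)) (x := x) v x) = v
  exact (congrArg₂ (fun (c : ℝ) (w : E) => c • w) h5 h4).trans (one_smul ℝ v)

lemma exists_fun [T2Space M] (x₀ : M) (x : M) (hx : x ∈ (extChartAt 𝓘(ℝ, E) x₀).source) (ℓ : E →L[ℝ] ℝ) :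
   ∃ f : M → ℝ, ContMDiff 𝓘(ℝ, E) 𝓘(ℝ, ℝ) ∞ f ∧ f =ᶠ[𝓝 x] ℓ ∘ extChartAt 𝓘(ℝ, E) x₀ := by
  have hs : (extChartAt 𝓘(ℝ, E) x₀).source ∈ 𝓝 x := (isOpen_extChartAt_source x₀).mem_nhds hx
  obtain ⟨ψ, h1, h2, h3⟩ := exists_bump (E := E) x hs
  refine ⟨fun y => ψ y * ℓ (extChartAt 𝓘(ℝ, E) x₀ y), ?_, ?_⟩
  · refine contMDiff_of_tsupport fun y hy => ?_
    have hy' := h3 (tsupport_mul_subset_left hy)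
    refine h1.contMDiffAt.mul (ℓ.contMDiff.contMDiffAt.comp y ?_)
    exact contMDiffOn_extChartAt.contMDiffAt ((chartAt E x₀).open_source.mem_nhds (by simpa using hy'))
  · filter_upwards [h2] with y hy
    simp [hy]

variable (E M) in
/-- Smooth differential `k`-forms on `M`: fields of alternating `k`-linear forms on the tangent
spaces whose coordinate expressions in all charts are smooth. -/
def Form (k : ℕ) : Submodule ℝ (M → E [⋀^Fin k]→L[ℝ] ℝ) where
  carrier := {a | ∀ x₀ : M, ContDiffOn ℝ ∞ (altRep a x₀) (extChartAt 𝓘(ℝ, E) x₀).target}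
  add_mem' ha hb x₀ := (ha x₀).add (hb x₀)
  zero_mem' _ := contDiffOn_const (c := (0 : E [⋀^Fin k]→L[ℝ] ℝ))
  smul_mem' c _ ha x₀ := (ha x₀).const_smul c

/-- The exterior derivative of a differential form, computed at `x` in the chart centred at `x`. -/
def extD {k : ℕ} (a : M → E [⋀^Fin k]→L[ℝ] ℝ) (x : M) : E [⋀^Fin (k + 1)]→L[ℝ] ℝ :=
  (extDeriv (altRep a x) (extChartAt 𝓘(ℝ, E) x x)).compContinuousLinearMap (dChart x x)

lemma extD_eq {k : ℕ} (a : M → E [⋀^Fin k]→L[ℝ] ℝ) (x : M) :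
    extD a x = extDeriv (altRep a x) (extChartAt 𝓘(ℝ, E) x x) := by
  unfold extD; rw [dChart_self]; ext; rfl

/-- The interior product `ι_X a`, given by `(ι_X a)(v₁, …) = a(X, v₁, …)`. -/
def iota {k : ℕ} (X : VF E M) (a : M → E [⋀^Fin (k + 1)]→L[ℝ] ℝ) (x : M) : E [⋀^Fin k]→L[ℝ] ℝ :=
  (a x).curryLeft (X x)

lemma iota_apply {k : ℕ} (X : VF E M) (a : M → E [⋀^Fin (k + 1)]→L[ℝ] ℝ) (x : M) (v : Fin k → E) :
    iota X a x v = a x (Matrix.vecCons (X x) v) := rfl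

lemma altRep_iota {k : ℕ} (X : VF E M) (a : M → E [⋀^Fin (k + 1)]→L[ℝ] ℝ) (x₀ : M) {u : E}
    (hu : u ∈ (extChartAt 𝓘(ℝ, E) x₀).target) :
    altRep (iota X a) x₀ u = (altRep a x₀ u).curryLeft (vecRep X x₀ u) := by
  ext v
  change a ((extChartAt 𝓘(ℝ, E) x₀).symm u) _ = a ((extChartAt 𝓘(ℝ, E) x₀).symm u) _
  congr 1
  ext i
  refine Fin.cases ?_ (fun i => ?_) i
  · exact (dChartSymm_vecRep X hu).symm
  · rfl

/-- Insertion of a vector in the first slot, as a continuous linear map. -/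
def curryCLM (k : ℕ) : (E [⋀^Fin (k + 1)]→L[ℝ] ℝ) →L[ℝ] (E →L[ℝ] E [⋀^Fin k]→L[ℝ] ℝ) :=
  (ContinuousAlternatingMap.curryLeftLI (𝕜 := ℝ) (E := E) (F := ℝ) (n := k)).toContinuousLinearMap

lemma iota_mem {k : ℕ} (X : VF E M) {a : M → E [⋀^Fin (k + 1)]→L[ℝ] ℝ} (ha : a ∈ Form E M (k + 1)) :
    iota X a ∈ Form E M k := by
  intro x₀
  refine ContDiffOn.congr ?_ (fun u hu => altRep_iota X a x₀ hu)
  exact ((curryCLM (E := E) k).contDiff.comp_contDiffOn (ha x₀)).clm_apply (vecRep_smooth X x₀)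

/-- A `0`-form as a function. -/
def toFun0 (a : M → E [⋀^Fin 0]→L[ℝ] ℝ) (x : M) : ℝ := a x ![]

lemma toFun0_smooth {a : M → E [⋀^Fin 0]→L[ℝ] ℝ} (ha : a ∈ Form E M 0) :
    ContMDiff 𝓘(ℝ, E) 𝓘(ℝ, ℝ) ∞ (toFun0 a) := by
  refine smooth_of_rep fun x₀ => ?_
  refine ContDiffOn.congr ((ContinuousAlternatingMap.apply ℝ E ℝ ![]).contDiff.comp_contDiffOn (ha x₀)) ?_
  intro u hu
  change a _ _ = a _ _
  congr 1
  ext i; exact i.elim0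

lemma ev1_smooth {a : M → E [⋀^Fin 1]→L[ℝ] ℝ} (ha : a ∈ Form E M 1) (X : VF E M) :
    ContMDiff 𝓘(ℝ, E) 𝓘(ℝ, ℝ) ∞ (fun x => a x ![X x]) :=
  toFun0_smooth (iota_mem X ha)

lemma ev3_smooth {a : M → E [⋀^Fin 3]→L[ℝ] ℝ} (ha : a ∈ Form E M 3) (X Y Z : VF E M) :
    ContMDiff 𝓘(ℝ, E) 𝓘(ℝ, ℝ) ∞ (fun x => a x ![X x, Y x, Z x]) :=
  toFun0_smooth (iota_mem Z (iota_mem Y (iota_mem X ha)))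

lemma altRep_apply {k : ℕ} (a : M → E [⋀^Fin k]→L[ℝ] ℝ) (x₀ : M) {u : E}
    (hu : u ∈ (extChartAt 𝓘(ℝ, E) x₀).target) (X : Fin k → VF E M) :
    altRep a x₀ u (fun i => vecRep (X i) x₀ u) = a ((extChartAt 𝓘(ℝ, E) x₀).symm u)
      (fun i => X i ((extChartAt 𝓘(ℝ, E) x₀).symm u)) := by
  change a _ _ = a _ _
  congr 1
  ext i
  exact dChartSymm_vecRep (X i) hu

lemma diffAt_altRep {k : ℕ} {a : M → E [⋀^Fin k]→L[ℝ] ℝ} (ha : a ∈ Form E M k) (x₀ : M) :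
    DifferentiableAt ℝ (altRep a x₀) (extChartAt 𝓘(ℝ, E) x₀ x₀) :=
  ((ha x₀).contDiffAt (tgt_nhds x₀)).differentiableAt (by simp)

lemma altRep_self {k : ℕ} (a : M → E [⋀^Fin k]→L[ℝ] ℝ) (x₀ : M) :
    altRep a x₀ (extChartAt 𝓘(ℝ, E) x₀ x₀) = a x₀ := by
  have h : (extChartAt 𝓘(ℝ, E) x₀).symm (extChartAt 𝓘(ℝ, E) x₀ x₀) = x₀ := extChartAt_to_inv x₀
  unfold altRep
  rw [h, dChartSymm_self]; ext; rfl

lemma koszul {k : ℕ} {a : M → E [⋀^Fin (k + 1)]→L[ℝ] ℝ} (ha : a ∈ Form E M (k + 1))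
    (hs : ∀ X : Fin (k + 1) → VF E M,
      ContMDiff 𝓘(ℝ, E) 𝓘(ℝ, ℝ) ∞ (fun x => a x (fun i => X i x)))
    (X : Fin (k + 2) → VF E M) (x : M) :
    extD a x (fun i => X i x) =
     (∑ i, (-1 : ℤ) ^ i.val • lieD (X i) (fun y => a y (fun j => i.removeNth X j y)) x) -
        ∑ i : Fin (k + 1), ∑ j ≥ i,
          (-1 : ℤ) ^ (i + j : ℕ) •
            a x (Matrix.vecCons (bracket (X i.castSucc) (X j.succ) x)
              (fun l => (j.removeNth <| i.castSucc.removeNth X) l x)) := by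
  have h := extDeriv_apply_vectorField (V := fun i => vecRep (X i) x) (diffAt_altRep ha x)
    (fun i => diffAt_vecRep (X i) x)
  rw [extD_eq]
  simp only [vecRep_self, altRep_self] at h
  rw [h]
  congr 1
  · refine Finset.sum_congr rfl fun i _ => ?_
    rw [lieD_self _ (hs _)]
    congr 2
    apply Filter.EventuallyEq.fderiv_eq
    filter_upwards [tgt_nhds x] with u hu
    exact altRep_apply a x hu (i.removeNth X)
  · refine Finset.sum_congr rfl fun i _ => Finset.sum_congr rfl fun j _ => ?_
    congr 2
    rw [bracket_self_pt]; rfl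

lemma vec1 (f : Fin 1 → E) : f = ![f 0] := by ext i; fin_cases i; rfl
lemma vec2 (f : Fin 2 → E) : f = ![f 0, f 1] := by ext i; fin_cases i <;> rfl
lemma vec3 (f : Fin 3 → E) : f = ![f 0, f 1, f 2] := by ext i; fin_cases i <;> rfl
lemma vec4 (f : Fin 4 → E) : f = ![f 0, f 1, f 2, f 3] := by ext i; fin_cases i <;> rfl

lemma extD_one {a : M → E [⋀^Fin 1]→L[ℝ] ℝ} (ha : a ∈ Form E M 1) (X Y : VF E M) (x : M) :
    extD a x ![X x, Y x] = lieD X (fun y => a y ![Y y]) x - lieD Y (fun y => a y ![X y]) x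
      - a x ![bracket X Y x] := by
  have h := koszul ha (fun X => by
    have : (fun x => a x (fun i => X i x)) = (fun x => a x ![X 0 x]) :=
      funext fun y => congrArg (a y) (vec1 (E := E) _)
    rw [this]
    exact ev1_smooth ha (X 0)) ![X, Y] x
  rw [Fin.sum_univ_two, Fin.sum_univ_one, show Finset.Ici (0 : Fin 1) = {0} from by decide,
    Finset.sum_singleton] at h
  refine (congrArg (extD a x) (vec2 (E := E) _)).symm.trans (h.trans ?_)
  have e0 : (fun y => a y (fun j => (0 : Fin 2).removeNth ![X, Y] j y)) = fun y => a y ![Y y] :=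
    funext fun y => congrArg (a y) (vec1 (E := E) _)
  have e1 : (fun y => a y (fun j => (1 : Fin 2).removeNth ![X, Y] j y)) = fun y => a y ![X y] :=
    funext fun y => congrArg (a y) (vec1 (E := E) _)
  rw [e0, e1]
  change (-1 : ℤ) ^ 0 • lieD X (fun y => a y ![Y y]) x + (-1 : ℤ) ^ 1 • lieD Y (fun y => a y ![X y]) x
    - (-1 : ℤ) ^ 0 • _ = _
  rw [show a x _ = a x ![bracket X Y x] from congrArg (a x) (vec1 (E := E) _)]
  simp; ring

lemma extD_three {a : M → E [⋀^Fin 3]→L[ℝ] ℝ} (ha : a ∈ Form E M 3) (X Y Z W : VF E M) (x : M) :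
    extD a x ![X x, Y x, Z x, W x] = lieD X (fun y => a y ![Y y, Z y, W y]) x
      - lieD Y (fun y => a y ![X y, Z y, W y]) x
      + lieD Z (fun y => a y ![X y, Y y, W y]) x
      - lieD W (fun y => a y ![X y, Y y, Z y]) x
      - a x ![bracket X Y x, Z x, W x] + a x ![bracket X Z x, Y x, W x]
      - a x ![bracket X W x, Y x, Z x] - a x ![bracket Y Z x, X x, W x]
      + a x ![bracket Y W x, X x, Z x] - a x ![bracket Z W x, X x, Y x] := by
  have h := koszul ha (fun X => by
    have : (fun x => a x (fun i => X i x)) = (fun x => a x ![X 0 x, X 1 x, X 2 x]) :=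
      funext fun y => congrArg (a y) (vec3 (E := E) _)
    rw [this]
    exact ev3_smooth ha (X 0) (X 1) (X 2)) ![X, Y, Z, W] x
  have I0 : Finset.Ici (0 : Fin 3) = {0, 1, 2} := by decide
  have I1 : Finset.Ici (1 : Fin 3) = {1, 2} := by decide
  have I2 : Finset.Ici (2 : Fin 3) = {2} := by decide
  rw [Fin.sum_univ_four, Fin.sum_univ_three, I0, I1, I2,
    Finset.sum_insert (by decide), Finset.sum_insert (by decide), Finset.sum_insert (by decide),
    Finset.sum_singleton, Finset.sum_singleton, Finset.sum_singleton] at h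
  refine (congrArg (extD a x) (vec4 (E := E) _)).symm.trans (h.trans ?_)
  have e0 : (fun y => a y (fun j => (0 : Fin 4).removeNth ![X, Y, Z, W] j y)) =
      fun y => a y ![Y y, Z y, W y] :=
    funext fun y => congrArg (a y) (vec3 (E := E) _)
  have e1 : (fun y => a y (fun j => (1 : Fin 4).removeNth ![X, Y, Z, W] j y)) =
      fun y => a y ![X y, Z y, W y] :=
    funext fun y => congrArg (a y) (vec3 (E := E) _)
  have e2 : (fun y => a y (fun j => (2 : Fin 4).removeNth ![X, Y, Z, W] j y)) =
      fun y => a y ![X y, Y y, W y] :=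
    funext fun y => congrArg (a y) (vec3 (E := E) _)
  have e3 : (fun y => a y (fun j => (3 : Fin 4).removeNth ![X, Y, Z, W] j y)) =
      fun y => a y ![X y, Y y, Z y] :=
    funext fun y => congrArg (a y) (vec3 (E := E) _)
  rw [e0, e1, e2, e3]
  have f00 : a x (Matrix.vecCons (bracket (![X, Y, Z, W] (0 : Fin 3).castSucc) (![X, Y, Z, W] (0 : Fin 3).succ) x)
      (fun l => ((0 : Fin 3).removeNth <| (0 : Fin 3).castSucc.removeNth ![X, Y, Z, W]) l x)) =
      a x ![bracket X Y x, Z x, W x] := congrArg (a x) (vec3 (E := E) _)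
  have f01 : a x (Matrix.vecCons (bracket (![X, Y, Z, W] (0 : Fin 3).castSucc) (![X, Y, Z, W] (1 : Fin 3).succ) x)
      (fun l => ((1 : Fin 3).removeNth <| (0 : Fin 3).castSucc.removeNth ![X, Y, Z, W]) l x)) =
      a x ![bracket X Z x, Y x, W x] := congrArg (a x) (vec3 (E := E) _)
  have f02 : a x (Matrix.vecCons (bracket (![X, Y, Z, W] (0 : Fin 3).castSucc) (![X, Y, Z, W] (2 : Fin 3).succ) x)
      (fun l => ((2 : Fin 3).removeNth <| (0 : Fin 3).castSucc.removeNth ![X, Y, Z, W]) l x)) =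
      a x ![bracket X W x, Y x, Z x] := congrArg (a x) (vec3 (E := E) _)
  have f11 : a x (Matrix.vecCons (bracket (![X, Y, Z, W] (1 : Fin 3).castSucc) (![X, Y, Z, W] (1 : Fin 3).succ) x)
      (fun l => ((1 : Fin 3).removeNth <| (1 : Fin 3).castSucc.removeNth ![X, Y, Z, W]) l x)) =
      a x ![bracket Y Z x, X x, W x] := congrArg (a x) (vec3 (E := E) _)
  have f12 : a x (Matrix.vecCons (bracket (![X, Y, Z, W] (1 : Fin 3).castSucc) (![X, Y, Z, W] (2 : Fin 3).succ) x)
      (fun l => ((2 : Fin 3).removeNth <| (1 : Fin 3).castSucc.removeNth ![X, Y, Z, W]) l x)) =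
      a x ![bracket Y W x, X x, Z x] := congrArg (a x) (vec3 (E := E) _)
  have f22 : a x (Matrix.vecCons (bracket (![X, Y, Z, W] (2 : Fin 3).castSucc) (![X, Y, Z, W] (2 : Fin 3).succ) x)
      (fun l => ((2 : Fin 3).removeNth <| (2 : Fin 3).castSucc.removeNth ![X, Y, Z, W]) l x)) =
      a x ![bracket Z W x, X x, Y x] := congrArg (a x) (vec3 (E := E) _)
  rw [f00, f01, f02, f11, f12, f22]
  change (-1 : ℤ) ^ 0 • lieD X _ x + (-1 : ℤ) ^ 1 • lieD Y _ x + (-1 : ℤ) ^ 2 • lieD Z _ x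
    + (-1 : ℤ) ^ 3 • lieD W _ x - ((-1 : ℤ) ^ 0 • _ + ((-1 : ℤ) ^ 1 • _ + (-1 : ℤ) ^ 2 • _) +
    ((-1 : ℤ) ^ 2 • _ + (-1 : ℤ) ^ 3 • _) + (-1 : ℤ) ^ 4 • _) = _
  have h3 : (-1 : ℤ) ^ 3 = -1 := by norm_num
  have h4 : (-1 : ℤ) ^ 4 = 1 := by norm_num
  have h2 : (-1 : ℤ) ^ 2 = 1 := by norm_num
  simp only [h2, h3, h4, pow_zero, pow_one, one_smul, neg_smul]
  ring

lemma ext_dual {v w : E} (h : ∀ ℓ : E →L[ℝ] ℝ, ℓ v = ℓ w) : v = w := by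
  by_contra hne
  obtain ⟨ℓ, hℓ⟩ := SeparatingDual.exists_separating_of_ne (R := ℝ) hne
  exact hℓ (h ℓ)

lemma dAt_add {f g : M → ℝ} (hf : ContMDiff 𝓘(ℝ, E) 𝓘(ℝ, ℝ) ∞ f)
    (hg : ContMDiff 𝓘(ℝ, E) 𝓘(ℝ, ℝ) ∞ g) (x : M) :
    dAt (E := E) (f + g) x = dAt (E := E) f x + dAt (E := E) g x :=
  mfderiv_add (hf.mdifferentiableAt (by simp)) (hg.mdifferentiableAt (by simp))

lemma dAt_smul {f : M → ℝ} (hf : ContMDiff 𝓘(ℝ, E) 𝓘(ℝ, ℝ) ∞ f) (c : ℝ) (x : M) :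
    dAt (E := E) (c • f) x = c • dAt (E := E) f x :=
  const_smul_mfderiv (hf.mdifferentiableAt (by simp)) c

lemma lieD_add (X : VF E M) {f g : M → ℝ} (hf : ContMDiff 𝓘(ℝ, E) 𝓘(ℝ, ℝ) ∞ f)
    (hg : ContMDiff 𝓘(ℝ, E) 𝓘(ℝ, ℝ) ∞ g) (x : M) :
    lieD X (f + g) x = lieD X f x + lieD X g x := by
  unfold lieD; rw [dAt_add hf hg]; rfl

lemma lieD_smul (X : VF E M) {f : M → ℝ} (hf : ContMDiff 𝓘(ℝ, E) 𝓘(ℝ, ℝ) ∞ f) (c : ℝ) (x : M) :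
    lieD X (c • f) x = c * lieD X f x := by
  unfold lieD; rw [dAt_smul hf]; rfl

lemma lieD_neg (X : VF E M) {f : M → ℝ} (hf : ContMDiff 𝓘(ℝ, E) 𝓘(ℝ, ℝ) ∞ f) (x : M) :
    lieD X (-f) x = - lieD X f x := by
  have := lieD_smul X hf (-1) x
  simpa using this

lemma lieD_sub (X : VF E M) {f g : M → ℝ} (hf : ContMDiff 𝓘(ℝ, E) 𝓘(ℝ, ℝ) ∞ f)
    (hg : ContMDiff 𝓘(ℝ, E) 𝓘(ℝ, ℝ) ∞ g) (x : M) :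
    lieD X (f - g) x = lieD X f x - lieD X g x := by
  rw [sub_eq_add_neg, lieD_add X hf (g := -g) hg.neg, lieD_neg X hg]; ring

lemma lieD_VF_add (X Y : VF E M) (f : M → ℝ) (x : M) :
    lieD (X + Y) f x = lieD X f x + lieD Y f x :=
  (dAt (E := E) f x).map_add (X x) (Y x)

lemma lieD_VF_smul (c : ℝ) (X : VF E M) (f : M → ℝ) (x : M) :
    lieD (c • X) f x = c * lieD X f x :=
  (dAt (E := E) f x).map_smul c (X x)

lemma lieD_VF_neg (X : VF E M) (f : M → ℝ) (x : M) :
    lieD (-X) f x = - lieD X f x :=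
  (dAt (E := E) f x).map_neg (X x)

/-- The differential `df` of a function, as a `1`-form. -/
def dFun (f : M → ℝ) (x : M) : E [⋀^Fin 1]→L[ℝ] ℝ :=
  ContinuousAlternatingMap.ofSubsingletonLIE (𝕜 := ℝ) (E := E) (F := ℝ) (0 : Fin 1) (dAt f x)

lemma dFun_apply (f : M → ℝ) (x : M) (v : E) : dFun f x ![v] = dAt (E := E) f x v := rfl

lemma dFun_mem {f : M → ℝ} (hf : ContMDiff 𝓘(ℝ, E) 𝓘(ℝ, ℝ) ∞ f) : dFun f ∈ Form E M 1 := by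
  intro x₀
  refine ContDiffOn.congr ((ContinuousAlternatingMap.ofSubsingletonLIE (𝕜 := ℝ) (E := E) (F := ℝ) (0 : Fin 1)).contDiff.comp_contDiffOn
    ((rep_smooth hf x₀).fderiv_of_isOpen (isOpen_tgt x₀) (m := ∞) (by simp))) ?_
  intro u hu
  rw [Function.comp_apply, fderiv_rep hf hu]
  rfl

lemma dFun_add {f g : M → ℝ} (hf : ContMDiff 𝓘(ℝ, E) 𝓘(ℝ, ℝ) ∞ f)
    (hg : ContMDiff 𝓘(ℝ, E) 𝓘(ℝ, ℝ) ∞ g) : dFun (E := E) (f + g) = dFun f + dFun g := by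
  funext x; unfold dFun; rw [dAt_add hf hg, map_add]; rfl

lemma dFun_smul {f : M → ℝ} (hf : ContMDiff 𝓘(ℝ, E) 𝓘(ℝ, ℝ) ∞ f) (c : ℝ) :
    dFun (E := E) (c • f) = c • dFun f := by
  funext x; unfold dFun; rw [dAt_smul hf, map_smul]; rfl

lemma extD_add {k : ℕ} {a b : M → E [⋀^Fin k]→L[ℝ] ℝ} (ha : a ∈ Form E M k) (hb : b ∈ Form E M k)
    (x : M) : extD (a + b) x = extD a x + extD b x := by
  rw [extD_eq, extD_eq, extD_eq]
  exact extDeriv_add (diffAt_altRep ha x) (diffAt_altRep hb x)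

lemma extD_smul {k : ℕ} (c : ℝ) (a : M → E [⋀^Fin k]→L[ℝ] ℝ)
    (x : M) : extD (c • a) x = c • extD a x := by
  rw [extD_eq, extD_eq]
  exact extDeriv_smul c (altRep a x)

section
variable [T2Space M]

lemma ext1 {x : M} {a b : E [⋀^Fin 1]→L[ℝ] ℝ} (h : ∀ X : VF E M, (a : E [⋀^Fin 1]→L[ℝ] ℝ) ![X x] = b ![X x]) : a = b := by
  ext v
  obtain ⟨X, hX⟩ := exists_VF (E := E) x (v 0)
  have hv : v = ![X x] := by rw [hX]; exact vec1 v
  rw [hv]; exact h X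

lemma ext2 {x : M} {a b : E [⋀^Fin 2]→L[ℝ] ℝ} (h : ∀ X Y : VF E M, a ![X x, Y x] = b ![X x, Y x]) :
    a = b := by
  ext v
  obtain ⟨X, hX⟩ := exists_VF (E := E) x (v 0)
  obtain ⟨Y, hY⟩ := exists_VF (E := E) x (v 1)
  have hv : v = ![X x, Y x] := by rw [hX, hY]; exact vec2 v
  rw [hv]; exact h X Y

lemma extD_dFun {f : M → ℝ} (hf : ContMDiff 𝓘(ℝ, E) 𝓘(ℝ, ℝ) ∞ f) (x : M) :
    extD (dFun (E := E) f) x = 0 := by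
  refine ext2 (x := x) fun X Y => ?_
  rw [extD_one (dFun_mem hf)]
  exact sub_eq_zero.2 (lieD_bracket X Y hf x).symm

lemma VF_ext {X Y : VF E M} (h : ∀ f : M → ℝ, ContMDiff 𝓘(ℝ, E) 𝓘(ℝ, ℝ) ∞ f → ∀ x, lieD X f x = lieD Y f x) :
    X = Y := by
  ext x
  refine ext_dual (E := E) ?_
  intro ℓ
  obtain ⟨f, hf, hf'⟩ := exists_fun (E := E) x x (mem_extChartAt_source x) ℓ
  have h1 := h f hf x
  rw [lieD_self _ hf, lieD_self _ hf] at h1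
  have h2 : (f ∘ (extChartAt 𝓘(ℝ, E) x).symm) =ᶠ[𝓝 (extChartAt 𝓘(ℝ, E) x x)] ℓ := by
    have h3 : Filter.Tendsto (extChartAt 𝓘(ℝ, E) x).symm (𝓝 (extChartAt 𝓘(ℝ, E) x x)) (𝓝 x) := by
      have := continuousAt_extChartAt_symm (I := 𝓘(ℝ, E)) x
      rwa [ContinuousAt, extChartAt_to_inv] at this
    filter_upwards [h3.eventually hf', tgt_nhds x] with u hu hu'
    simp only [Function.comp_apply, hu, (extChartAt 𝓘(ℝ, E) x).right_inv hu']
  rw [h2.fderiv_eq, ℓ.fderiv] at h1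
  exact h1
end

lemma alt3_swap01 (a : E [⋀^Fin 3]→L[ℝ] ℝ) (u v w : E) : a ![u, v, w] = - a ![v, u, w] := by
  have := a.toAlternatingMap.map_swap ![v, u, w] (i := 0) (j := 1) (by decide)
  rw [← show ![u, v, w] = ![v, u, w] ∘ (Equiv.swap (0 : Fin 3) 1) from by
    ext i; fin_cases i <;> rfl] at this
  exact this

lemma alt3_swap12 (a : E [⋀^Fin 3]→L[ℝ] ℝ) (u v w : E) : a ![u, v, w] = - a ![u, w, v] := by
  have := a.toAlternatingMap.map_swap ![u, w, v] (i := 1) (j := 2) (by decide)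
  rw [← show ![u, v, w] = ![u, w, v] ∘ (Equiv.swap (1 : Fin 3) 2) from by
    ext i; fin_cases i <;> rfl] at this
  exact this

lemma alt2_swap (a : E [⋀^Fin 2]→L[ℝ] ℝ) (u v : E) : a ![u, v] = - a ![v, u] := by
  have := a.toAlternatingMap.map_swap ![v, u] (i := 0) (j := 1) (by decide)
  rw [← show ![u, v] = ![v, u] ∘ (Equiv.swap (0 : Fin 2) 1) from by
    ext i; fin_cases i <;> rfl] at this
  exact this

lemma alt_cons_add {k : ℕ} (a : E [⋀^Fin (k + 1)]→L[ℝ] ℝ) (u v : E) (w : Fin k → E) :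
    a (Matrix.vecCons (u + v) w) = a (Matrix.vecCons u w) + a (Matrix.vecCons v w) :=
  a.toAlternatingMap.map_vecCons_add w u v

lemma alt_cons_smul {k : ℕ} (a : E [⋀^Fin (k + 1)]→L[ℝ] ℝ) (c : ℝ) (v : E) (w : Fin k → E) :
    a (Matrix.vecCons (c • v) w) = c * a (Matrix.vecCons v w) :=
  a.toAlternatingMap.map_vecCons_smul w c v

lemma alt_cons_neg {k : ℕ} (a : E [⋀^Fin (k + 1)]→L[ℝ] ℝ) (v : E) (w : Fin k → E) :
    a (Matrix.vecCons (-v) w) = - a (Matrix.vecCons v w) := by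
  have := alt_cons_smul a (-1) v w
  simpa using this

/-- The function `a(A)`. -/
def ev1 (a : M → E [⋀^Fin 1]→L[ℝ] ℝ) (A : VF E M) (x : M) : ℝ := a x ![A x]
/-- The function `a(A, B, C)`. -/
def ev3 (a : M → E [⋀^Fin 3]→L[ℝ] ℝ) (A B C : VF E M) (x : M) : ℝ := a x ![A x, B x, C x]

lemma ev3_swap01 (a : M → E [⋀^Fin 3]→L[ℝ] ℝ) (A B C : VF E M) :
    ev3 a A B C = - ev3 a B A C := funext fun x => alt3_swap01 (E := E) (a x) (A x : E) (B x : E) (C x : E)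
lemma ev3_swap12 (a : M → E [⋀^Fin 3]→L[ℝ] ℝ) (A B C : VF E M) :
    ev3 a A B C = - ev3 a A C B := funext fun x => alt3_swap12 (E := E) (a x) (A x : E) (B x : E) (C x : E)
lemma ev3_rot (a : M → E [⋀^Fin 3]→L[ℝ] ℝ) (A B C : VF E M) :
    ev3 a A B C = ev3 a B C A := by
  rw [ev3_swap01, ev3_swap12 a B A C, neg_neg]
lemma ev3_add (a : M → E [⋀^Fin 3]→L[ℝ] ℝ) (A A' B C : VF E M) :
    ev3 a (A + A') B C = ev3 a A B C + ev3 a A' B C :=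
  funext fun x => alt_cons_add (E := E) (a x) (A x : E) (A' x : E) ![(B x : E), C x]
lemma ev3_smul (a : M → E [⋀^Fin 3]→L[ℝ] ℝ) (c : ℝ) (A B C : VF E M) :
    ev3 a (c • A) B C = c • ev3 a A B C :=
  funext fun x => alt_cons_smul (E := E) (a x) c (A x : E) ![(B x : E), C x]
lemma ev3_neg (a : M → E [⋀^Fin 3]→L[ℝ] ℝ) (A B C : VF E M) :
    ev3 a (-A) B C = - ev3 a A B C :=
  funext fun x => alt_cons_neg (E := E) (a x) (A x : E) ![(B x : E), C x]
lemma ev1_add_right (a : M → E [⋀^Fin 1]→L[ℝ] ℝ) (A A' : VF E M) :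
    ev1 a (A + A') = ev1 a A + ev1 a A' :=
  funext fun x => alt_cons_add (E := E) (a x) (A x : E) (A' x : E) ![]
lemma ev1_neg_right (a : M → E [⋀^Fin 1]→L[ℝ] ℝ) (A : VF E M) :
    ev1 a (-A) = - ev1 a A :=
  funext fun x => alt_cons_neg (E := E) (a x) (A x : E) ![]

lemma ev3_self (a : M → E [⋀^Fin 3]→L[ℝ] ℝ) (A B : VF E M) : ev3 a A A B = 0 := by
  have h := ev3_swap01 a A A B
  funext x
  have := congrFun h x
  simp only [Pi.neg_apply] at this
  simp only [Pi.zero_apply]; linarith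

section
variable [T2Space M]

lemma bracket_swap (A B : VF E M) : bracket A B = - bracket B A := by
  refine VF_ext fun f hf x => ?_
  rw [lieD_VF_neg, lieD_bracket _ _ hf, lieD_bracket _ _ hf]; ring

lemma bracket_add_left (A B C : VF E M) : bracket (A + B) C = bracket A C + bracket B C := by
  refine VF_ext fun f hf x => ?_
  have e : lieD (A + B) f = lieD A f + lieD B f := funext fun y => lieD_VF_add A B f y
  rw [lieD_VF_add, lieD_bracket _ _ hf, lieD_bracket _ _ hf, lieD_bracket _ _ hf, lieD_VF_add, e,
    lieD_add _ (lieD_smooth _ hf) (lieD_smooth _ hf)]; ring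

lemma bracket_smul_left (c : ℝ) (A C : VF E M) : bracket (c • A) C = c • bracket A C := by
  refine VF_ext fun f hf x => ?_
  have e : lieD (c • A) f = c • lieD A f := funext fun y => lieD_VF_smul c A f y
  rw [lieD_VF_smul, lieD_bracket _ _ hf, lieD_bracket _ _ hf, lieD_VF_smul, e,
    lieD_smul _ (lieD_smooth _ hf)]; ring

lemma bracket_add_right (A B C : VF E M) : bracket A (B + C) = bracket A B + bracket A C := by
  rw [bracket_swap, bracket_add_left, bracket_swap A B, bracket_swap A C, neg_add]

lemma bracket_smul_right (c : ℝ) (A C : VF E M) : bracket A (c • C) = c • bracket A C := by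
  rw [bracket_swap, bracket_smul_left, bracket_swap A C, smul_neg]

lemma bracket_neg_left (A C : VF E M) : bracket (-A) C = -bracket A C := by
  have := bracket_smul_left (-1) A C
  simpa using this

lemma bracket_neg_right (A C : VF E M) : bracket A (-C) = -bracket A C := by
  have := bracket_smul_right (-1) A C
  simpa using this

lemma bracket_self (A : VF E M) : bracket A A = 0 := by
  have h := bracket_swap A A
  have h2 : (2 : ℝ) • bracket A A = 0 := by rw [two_smul]; nth_rw 2 [h]; abel
  simpa using h2

lemma bracket_jacobi (A B C : VF E M) :
    bracket A (bracket B C) = bracket (bracket A B) C + bracket B (bracket A C) := by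
  refine VF_ext fun f hf x => ?_
  have e : ∀ A B : VF E M, lieD (bracket A B) f = lieD A (lieD B f) - lieD B (lieD A f) :=
    fun A B => funext fun y => lieD_bracket A B hf y
  have s : ∀ A B : VF E M, ContMDiff 𝓘(ℝ, E) 𝓘(ℝ, ℝ) ∞ (lieD A (lieD B f)) :=
    fun A B => lieD_smooth A (lieD_smooth B hf)
  rw [lieD_VF_add]
  simp only [e, lieD_bracket _ _ hf, lieD_bracket _ _ (lieD_smooth _ hf), lieD_sub _ (s _ _) (s _ _)]
  ring
end

/-- `X` is a Hamiltonian vector field of the `1`-form `α`: `dα = -ι_X Ω`. -/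
def IsHamiltonianFor (Ω : M → E [⋀^Fin 3]→L[ℝ] ℝ) (α : M → E [⋀^Fin 1]→L[ℝ] ℝ) (X : VF E M) : Prop :=
  ∀ x, extD α x = - iota X Ω x

lemma ham_eq {Ω : M → E [⋀^Fin 3]→L[ℝ] ℝ} {α : M → E [⋀^Fin 1]→L[ℝ] ℝ} (hα : α ∈ Form E M 1) {X : VF E M}
    (h : IsHamiltonianFor Ω α X) (A B : VF E M) (x : M) :
    lieD A (ev1 α B) x - lieD B (ev1 α A) x - ev1 α (bracket A B) x = - ev3 Ω X A B x := by
  rw [show ev1 α = fun A x => α x ![A x] from rfl]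
  refine (extD_one hα A B x).symm.trans ?_
  rw [h x]; rfl

section
variable [T2Space M]

lemma lieD_ev3_of_ham {Ω : M → E [⋀^Fin 3]→L[ℝ] ℝ} (hΩ : Ω ∈ Form E M 3) (hd : ∀ x, extD Ω x = 0)
    {α : M → E [⋀^Fin 1]→L[ℝ] ℝ} (hα : α ∈ Form E M 1) {X : VF E M}
    (h : IsHamiltonianFor Ω α X) (A B C : VF E M) (x : M) :
    lieD X (ev3 Ω A B C) x = ev3 Ω (bracket X A) B C x + ev3 Ω A (bracket X B) C x
     + ev3 Ω A B (bracket X C) x := by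
  have h1 : extD Ω x ![X x, A x, B x, C x] = 0 := by rw [hd x]; rfl
  rw [extD_three hΩ] at h1
  change lieD X (ev3 Ω A B C) x - lieD A (ev3 Ω X B C) x + lieD B (ev3 Ω X A C) x -
    lieD C (ev3 Ω X A B) x - ev3 Ω (bracket X A) B C x + ev3 Ω (bracket X B) A C x
    - ev3 Ω (bracket X C) A B x - ev3 Ω (bracket A B) X C x + ev3 Ω (bracket A C) X B x
    - ev3 Ω (bracket B C) X A x = 0 at h1
  have s1 : ∀ A : VF E M, ContMDiff 𝓘(ℝ, E) 𝓘(ℝ, ℝ) ∞ (ev1 α A) := fun A => ev1_smooth hα A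
  have e : ∀ A B : VF E M, ev3 Ω X A B =
    ev1 α (bracket A B) - (lieD A (ev1 α B) - lieD B (ev1 α A)) := fun A B => by
    funext y; have := ham_eq hα h A B y
    simp only [Pi.sub_apply]; linarith
  have r : ∀ A B D : VF E M, ev3 Ω (bracket A B) X D x = - ev3 Ω X (bracket A B) D x := fun A B D =>
    congrFun (ev3_swap01 Ω _ _ _) x
  have r1 : ∀ D : VF E M, ev3 Ω D A C x = - ev3 Ω A D C x := fun D => congrFun (ev3_swap01 Ω _ _ _) x
  have r2 : ∀ D : VF E M, ev3 Ω D A B x = ev3 Ω A B D x := fun D => congrFun (ev3_rot Ω _ _ _) x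
  have j := congrFun (congrArg (ev1 α) (bracket_jacobi A B C)) x
  rw [ev1_add_right, bracket_swap (bracket A B) C, bracket_swap B (bracket A C), ev1_neg_right,
    ev1_neg_right] at j
  have j2 := bracket_swap C (bracket A B)
  simp only [r, r1, r2, e] at h1
  have s2 : ∀ A B : VF E M, ContMDiff 𝓘(ℝ, E) 𝓘(ℝ, ℝ) ∞ (lieD A (ev1 α B)) :=
    fun A B => lieD_smooth A (s1 B)
  have s3 : ∀ A B : VF E M, ContMDiff 𝓘(ℝ, E) 𝓘(ℝ, ℝ) ∞ (lieD A (ev1 α B) - lieD B (ev1 α A)) :=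
    fun A B => (s2 A B).sub (s2 B A)
  simp only [lieD_sub _ (s1 _) (s3 _ _), lieD_sub _ (s2 _ _) (s2 _ _), Pi.sub_apply,
     lieD_bracket _ _ (s1 _)] at h1
  simp only [Pi.add_apply, Pi.neg_apply] at j
  have j3 := congrFun (congrArg (ev1 α) (bracket_swap C (bracket A B))) x
  have j4 := congrFun (congrArg (ev1 α) (bracket_swap B (bracket A C))) x
  have j5 := congrFun (congrArg (ev1 α) (bracket_swap A (bracket B C))) x
  rw [ev1_neg_right] at j3 j4 j5
  simp only [Pi.neg_apply] at j3 j4 j5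
  linarith

lemma isHamiltonianFor_bracket {Ω : M → E [⋀^Fin 3]→L[ℝ] ℝ} (hΩ : Ω ∈ Form E M 3) (hd : ∀ x, extD Ω x = 0)
    {α β : M → E [⋀^Fin 1]→L[ℝ] ℝ} (hα : α ∈ Form E M 1) (hβ : β ∈ Form E M 1) {X Y : VF E M}
    (h : IsHamiltonianFor Ω α X) (h' : IsHamiltonianFor Ω β Y) : IsHamiltonianFor Ω (iota Y (iota X Ω)) (bracket X Y) := by
  intro x
  refine ext2 (x := x) fun A B => ?_
  rw [extD_one (iota_mem Y (iota_mem X hΩ))]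
  change lieD A (ev3 Ω X Y B) x - lieD B (ev3 Ω X Y A) x - ev3 Ω X Y (bracket A B) x =
    - ev3 Ω (bracket X Y) A B x
  have h1 : extD Ω x ![X x, Y x, A x, B x] = 0 := by rw [hd x]; rfl
  rw [extD_three hΩ] at h1
  change lieD X (ev3 Ω Y A B) x - lieD Y (ev3 Ω X A B) x + lieD A (ev3 Ω X Y B) x -
    lieD B (ev3 Ω X Y A) x - ev3 Ω (bracket X Y) A B x + ev3 Ω (bracket X A) Y B x
    - ev3 Ω (bracket X B) Y A x - ev3 Ω (bracket Y A) X B x + ev3 Ω (bracket Y B) X A x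
    - ev3 Ω (bracket A B) X Y x = 0 at h1
  have p := lieD_ev3_of_ham hΩ hd hα h Y A B x
  have q := lieD_ev3_of_ham hΩ hd hβ h' X A B x
  have r1 := congrFun (ev3_rot Ω (bracket A B) X Y) x
  have r2 : ∀ D B : VF E M, ev3 Ω D Y B x = - ev3 Ω Y D B x := fun D B => congrFun (ev3_swap01 Ω _ _ _) x
  have r3 : ∀ D B : VF E M, ev3 Ω D X B x = - ev3 Ω X D B x := fun D B => congrFun (ev3_swap01 Ω _ _ _) x
  have r4 : ∀ A D B : VF E M, ev3 Ω A D B x = - ev3 Ω A B D x := fun A D B => congrFun (ev3_swap12 Ω _ _ _) x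
  rw [r4 Y A] at p
  rw [r4 X A] at q
  rw [bracket_swap Y X, ev3_neg, Pi.neg_apply] at q
  rw [r2, r2, r3, r3, r1] at h1
  have := r4 Y A (bracket X B)
  have := r4 X A (bracket Y B)
  have := r4 Y (bracket X B) A
  have := r4 X (bracket Y B) A
  have := r4 Y (bracket X A) B
  have := r4 X (bracket Y A) B
  linarith
end

section
variable [T2Space M]
lemma lieD_ev3_ham {Ω : M → E [⋀^Fin 3]→L[ℝ] ℝ} (hΩ : Ω ∈ Form E M 3) (hd : ∀ x, extD Ω x = 0)
    {α β γ : M → E [⋀^Fin 1]→L[ℝ] ℝ} (hα : α ∈ Form E M 1) (hβ : β ∈ Form E M 1)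
    (hγ : γ ∈ Form E M 1) {X Y Z : VF E M}
    (h : IsHamiltonianFor Ω α X) (h' : IsHamiltonianFor Ω β Y) (h'' : IsHamiltonianFor Ω γ Z) (W : VF E M) (x : M) :
    lieD W (ev3 Ω X Y Z) x = ev3 Ω (bracket X Y) Z W x + ev3 Ω (bracket Y Z) X W x
      + ev3 Ω (bracket Z X) Y W x := by
  have h1 : extD Ω x ![X x, Y x, Z x, W x] = 0 := by rw [hd x]; rfl
  rw [extD_three hΩ] at h1
  change lieD X (ev3 Ω Y Z W) x - lieD Y (ev3 Ω X Z W) x + lieD Z (ev3 Ω X Y W) x -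
    lieD W (ev3 Ω X Y Z) x - ev3 Ω (bracket X Y) Z W x + ev3 Ω (bracket X Z) Y W x
    - ev3 Ω (bracket X W) Y Z x - ev3 Ω (bracket Y Z) X W x + ev3 Ω (bracket Y W) X Z x
    - ev3 Ω (bracket Z W) X Y x = 0 at h1
  have p := lieD_ev3_of_ham hΩ hd hα h Y Z W x
  have q := lieD_ev3_of_ham hΩ hd hβ h' X Z W x
  have r := lieD_ev3_of_ham hΩ hd hγ h'' X Y W x
  have s0 : ∀ A B C : VF E M, ev3 Ω A B C x = - ev3 Ω B A C x := fun A B C =>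
    congrFun (ev3_swap01 Ω _ _ _) x
  rw [s0 Y (bracket X Z)] at p
  rw [s0 X (bracket Y Z)] at q
  rw [s0 X (bracket Z Y)] at r
  rw [bracket_swap Y X, ev3_neg, Pi.neg_apply] at q
  rw [bracket_swap Z X, bracket_swap Z Y] at r
  rw [bracket_swap Z X]
  simp only [ev3_neg, Pi.neg_apply] at r ⊢
  have := congrFun (ev3_rot Ω (bracket X W) Y Z) x
  have := congrFun (ev3_rot Ω (bracket Y W) X Z) x
  have := congrFun (ev3_rot Ω (bracket Z W) X Y) x
  linarith

lemma ev3_bracket_ham {Ω : M → E [⋀^Fin 3]→L[ℝ] ℝ} (hΩ : Ω ∈ Form E M 3) (hd : ∀ x, extD Ω x = 0)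
    {α β γ δ : M → E [⋀^Fin 1]→L[ℝ] ℝ} (hα : α ∈ Form E M 1) (hβ : β ∈ Form E M 1)
    (hγ : γ ∈ Form E M 1) (hδ : δ ∈ Form E M 1) {X Y Z T : VF E M}
    (h : IsHamiltonianFor Ω α X) (h' : IsHamiltonianFor Ω β Y) (h'' : IsHamiltonianFor Ω γ Z) (h3 : IsHamiltonianFor Ω δ T) (x : M) :
    ev3 Ω (bracket X Y) Z T x - ev3 Ω (bracket X Z) Y T x + ev3 Ω (bracket X T) Y Z x
      + ev3 Ω (bracket Y Z) X T x - ev3 Ω (bracket Y T) X Z x + ev3 Ω (bracket Z T) X Y x = 0 := by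
  have p := lieD_ev3_ham hΩ hd hα hβ hγ h h' h'' T x
  rw [lieD_ev3_of_ham hΩ hd hδ h3] at p
  have s0 : ∀ A B C : VF E M, ev3 Ω A B C x = - ev3 Ω B A C x := fun A B C =>
    congrFun (ev3_swap01 Ω _ _ _) x
  rw [s0 X (bracket T Y), bracket_swap T X, bracket_swap T Y, bracket_swap T Z, bracket_swap Z X,
    ← ev3_rot Ω _ X Y] at p
  simp only [ev3_neg, Pi.neg_apply] at p
  linarith
end

/-- The dual space of `E`, which models the cotangent spaces of `M`. -/
abbrev Covector (E : Type*) [NormedAddCommGroup E] [NormedSpace ℝ E] := E →L[ℝ] ℝ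

/-- Bilinear forms on the dual space. As `E` is finite-dimensional, `∧² E` is the space of alternating
ones, where `X ∧ Y` is `(ξ, η) ↦ ξ(X) η(Y) - ξ(Y) η(X)`. -/
abbrev BivectorAt (E : Type*) [NormedAddCommGroup E] [NormedSpace ℝ E] :=  Covector E →L[ℝ] Covector E →L[ℝ] ℝ

/-- Precomposition of covectors with an endomorphism. -/
def precomp (A : E →L[ℝ] E) : Covector E →L[ℝ] Covector E := (ContinuousLinearMap.compL ℝ E E ℝ).flip A

lemma precomp_apply (A : E →L[ℝ] E) (ξ : Covector E) : precomp A ξ = ξ.comp A := rfl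

/-- The coordinate expression of a field of bilinear forms on covectors in the chart centred at `x₀`. -/
def bivRep (v : M → BivectorAt E) (x₀ : M) (u : E) : BivectorAt E :=
  (v ((extChartAt 𝓘(ℝ, E) x₀).symm u)).bilinearComp
    (precomp (dChart x₀ ((extChartAt 𝓘(ℝ, E) x₀).symm u)))
    (precomp (dChart x₀ ((extChartAt 𝓘(ℝ, E) x₀).symm u)))

lemma bivRep_apply (v : M → BivectorAt E) (x₀ : M) (u : E) (ξ η : Covector E) : bivRep v x₀ u ξ η =
    v ((extChartAt 𝓘(ℝ, E) x₀).symm u) (ξ.comp (dChart x₀ ((extChartAt 𝓘(ℝ, E) x₀).symm u)))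
     (η.comp (dChart x₀ ((extChartAt 𝓘(ℝ, E) x₀).symm u))) := rfl

variable (E M) in
/-- Smooth bivector fields on `M`. -/
def bivectorFields : Submodule ℝ (M → BivectorAt E) where
  carrier := {v | (∀ x ξ, v x ξ ξ = 0) ∧
    ∀ x₀ : M, ContDiffOn ℝ ∞ (bivRep v x₀) (extChartAt 𝓘(ℝ, E) x₀).target}
  add_mem' {v w} hv hw := ⟨fun x ξ => by
    change v x ξ ξ + w x ξ ξ = 0
    rw [hv.1, hw.1, add_zero], fun x₀ => (hv.2 x₀).add (hw.2 x₀)⟩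
  zero_mem' := ⟨fun _ _ => rfl, fun _ => contDiffOn_const (c := (0 : BivectorAt E))⟩
  smul_mem' c v hv := ⟨fun x ξ => by
    change c * v x ξ ξ = 0
    rw [hv.1, mul_zero], fun x₀ => (hv.2 x₀).const_smul c⟩

/-- The function `v(df, dg)`. -/
def evF (v : M → BivectorAt E) (f g : M → ℝ) (x : M) : ℝ := v x (dAt f x) (dAt g x)

lemma dAt_eq {f : M → ℝ} (hf : ContMDiff 𝓘(ℝ, E) 𝓘(ℝ, ℝ) ∞ f) {x₀ : M} {u : E}
    (hu : u ∈ (extChartAt 𝓘(ℝ, E) x₀).target) :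
    (fderiv ℝ (f ∘ (extChartAt 𝓘(ℝ, E) x₀).symm) u).comp (dChart x₀ ((extChartAt 𝓘(ℝ, E) x₀).symm u)) =
     dAt (E := E) f ((extChartAt 𝓘(ℝ, E) x₀).symm u) := by
  rw [fderiv_rep hf hu]
  ext w
  simp only [ContinuousLinearMap.comp_apply]
  exact congrArg (dAt (E := E) f ((extChartAt 𝓘(ℝ, E) x₀).symm u)) (dChartSymm_comp hu w)

lemma evF_rep (v : M → BivectorAt E) {f g : M → ℝ} (hf : ContMDiff 𝓘(ℝ, E) 𝓘(ℝ, ℝ) ∞ f)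
    (hg : ContMDiff 𝓘(ℝ, E) 𝓘(ℝ, ℝ) ∞ g) {x₀ : M} {u : E}
    (hu : u ∈ (extChartAt 𝓘(ℝ, E) x₀).target) :
    evF v f g ((extChartAt 𝓘(ℝ, E) x₀).symm u) = bivRep v x₀ u
     (fderiv ℝ (f ∘ (extChartAt 𝓘(ℝ, E) x₀).symm) u) (fderiv ℝ (g ∘ (extChartAt 𝓘(ℝ, E) x₀).symm) u) := by
  rw [bivRep_apply, dAt_eq hf hu, dAt_eq hg hu]; rfl

lemma evF_smooth {v : M → BivectorAt E} (hv : v ∈ bivectorFields E M) {f g : M → ℝ} (hf : ContMDiff 𝓘(ℝ, E) 𝓘(ℝ, ℝ) ∞ f)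
    (hg : ContMDiff 𝓘(ℝ, E) 𝓘(ℝ, ℝ) ∞ g) : ContMDiff 𝓘(ℝ, E) 𝓘(ℝ, ℝ) ∞ (evF v f g) := by
  refine smooth_of_rep fun x₀ => ?_
  refine ContDiffOn.congr ?_ (fun u hu => evF_rep v hf hg hu)
  exact ((hv.2 x₀).clm_apply ((rep_smooth hf x₀).fderiv_of_isOpen (isOpen_tgt x₀) (by simp))).clm_apply
    ((rep_smooth hg x₀).fderiv_of_isOpen (isOpen_tgt x₀) (by simp))

section
variable [T2Space M]

lemma exists_fun' (x₀ : M) {u : E} (hu : u ∈ (extChartAt 𝓘(ℝ, E) x₀).target) (ℓ : E →L[ℝ] ℝ) :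
    ∃ f : M → ℝ, ContMDiff 𝓘(ℝ, E) 𝓘(ℝ, ℝ) ∞ f ∧
      (f ∘ (extChartAt 𝓘(ℝ, E) x₀).symm) =ᶠ[𝓝 u] ℓ := by
  obtain ⟨f, hf, hf'⟩ := exists_fun (E := E) x₀ _ ((extChartAt 𝓘(ℝ, E) x₀).map_target hu) ℓ
  refine ⟨f, hf, ?_⟩
  have h3 := (continuousAt_extChartAt_symm'' (I := 𝓘(ℝ, E)) hu)
  filter_upwards [h3.eventually hf', (isOpen_tgt x₀).mem_nhds hu] with u hu hu'
  simp only [Function.comp_apply, hu, (extChartAt 𝓘(ℝ, E) x₀).right_inv hu']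

lemma biv_smooth {v : M → BivectorAt E} (h : ∀ f g : M → ℝ, ContMDiff 𝓘(ℝ, E) 𝓘(ℝ, ℝ) ∞ f →
    ContMDiff 𝓘(ℝ, E) 𝓘(ℝ, ℝ) ∞ g → ContMDiff 𝓘(ℝ, E) 𝓘(ℝ, ℝ) ∞ (evF v f g)) (x₀ : M) :
    ContDiffOn ℝ ∞ (bivRep v x₀) (extChartAt 𝓘(ℝ, E) x₀).target := by
  refine contDiffOn_clm_apply.2 fun ξ => contDiffOn_clm_apply.2 fun η => ?_
  intro u hu
  obtain ⟨f, hf, hf'⟩ := exists_fun' x₀ hu ξ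
  obtain ⟨g, hg, hg'⟩ := exists_fun' x₀ hu η
  have h1 := (rep_smooth (h f g hf hg) x₀).contDiffAt ((isOpen_tgt x₀).mem_nhds hu)
  refine (h1.congr_of_eventuallyEq ?_).contDiffWithinAt
  filter_upwards [hf'.eventuallyEq_nhds, hg'.eventuallyEq_nhds, (isOpen_tgt x₀).mem_nhds hu] with z h1 h2 h3
  rw [Function.comp_apply, evF_rep v hf hg h3, h1.fderiv_eq, h2.fderiv_eq, ξ.fderiv, η.fderiv]

lemma exists_dAt (x : M) (ξ : E →L[ℝ] ℝ) : ∃ f : M → ℝ, ContMDiff 𝓘(ℝ, E) 𝓘(ℝ, ℝ) ∞ f ∧ dAt (E := E) f x = ξ := by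
  obtain ⟨f, hf, hf'⟩ := exists_fun' x (mem_extChartAt_target (I := 𝓘(ℝ, E)) x) ξ
  refine ⟨f, hf, ?_⟩
  have := dAt_eq hf (mem_extChartAt_target (I := 𝓘(ℝ, E)) x)
  rw [hf'.fderiv_eq, ξ.fderiv, extChartAt_to_inv x, dChart_self] at this
  rw [← this]; rfl

lemma biv_ext {v w : M → BivectorAt E} (h : ∀ f g : M → ℝ, ContMDiff 𝓘(ℝ, E) 𝓘(ℝ, ℝ) ∞ f →
    ContMDiff 𝓘(ℝ, E) 𝓘(ℝ, ℝ) ∞ g → ∀ x, evF v f g x = evF w f g x) : v = w := by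
  funext x
  ext ξ η
  obtain ⟨f, hf, hf'⟩ := exists_dAt x ξ
  obtain ⟨g, hg, hg'⟩ := exists_dAt x η
  rw [← hf', ← hg']
  exact h f g hf hg x
end

/-- The Schouten bracket `[X, v]` of a vector field and a bivector field, that is, the Lie derivative of
`v` along `X`. In a chart, `[X, v](ξ, η) = (D_X v)(ξ, η) - v(ξ ∘ DX, η) - v(ξ, η ∘ DX)`; hence
`[X, Y ∧ Z] = [X, Y] ∧ Z + Y ∧ [X, Z]`. -/
def schouten (X : VF E M) (v : M → BivectorAt E) (x : M) : BivectorAt E :=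
  fderiv ℝ (bivRep v x) (extChartAt 𝓘(ℝ, E) x x) (vecRep X x (extChartAt 𝓘(ℝ, E) x x))
  - (bivRep v x (extChartAt 𝓘(ℝ, E) x x)).comp
      (precomp (fderiv ℝ (vecRep X x) (extChartAt 𝓘(ℝ, E) x x)))
  - (bivRep v x (extChartAt 𝓘(ℝ, E) x x)).bilinearComp (.id ℝ _)
      (precomp (fderiv ℝ (vecRep X x) (extChartAt 𝓘(ℝ, E) x x)))

lemma bivRep_self (v : M → BivectorAt E) (x : M) : bivRep v x (extChartAt 𝓘(ℝ, E) x x) = v x := by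
  ext ξ η
  rw [bivRep_apply, extChartAt_to_inv x, dChart_self]; rfl

lemma dAt_self {f : M → ℝ} (hf : ContMDiff 𝓘(ℝ, E) 𝓘(ℝ, ℝ) ∞ f) (x : M) :
    dAt (E := E) f x = fderiv ℝ (f ∘ (extChartAt 𝓘(ℝ, E) x).symm) (extChartAt 𝓘(ℝ, E) x x) := by
  have := dAt_eq hf (mem_extChartAt_target (I := 𝓘(ℝ, E)) x)
  rw [extChartAt_to_inv x, dChart_self] at this
  exact this.symm

lemma evF_schouten (X : VF E M) {v : M → BivectorAt E} (hv : v ∈ bivectorFields E M) {f g : M → ℝ} (hf : ContMDiff 𝓘(ℝ, E) 𝓘(ℝ, ℝ) ∞ f)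
    (hg : ContMDiff 𝓘(ℝ, E) 𝓘(ℝ, ℝ) ∞ g) (x : M) :
    evF (schouten X v) f g x = lieD X (evF v f g) x - evF v (lieD X f) g x - evF v f (lieD X g) x := by
  set y := extChartAt 𝓘(ℝ, E) x x with hy
  have T := tgt_nhds (E := E) x
  rw [lieD_self X (evF_smooth hv hf hg), ← vecRep_self X x]
  have e1 : (evF v f g ∘ (extChartAt 𝓘(ℝ, E) x).symm) =ᶠ[𝓝 y] fun u => bivRep v x u
     (fderiv ℝ (f ∘ (extChartAt 𝓘(ℝ, E) x).symm) u) (fderiv ℝ (g ∘ (extChartAt 𝓘(ℝ, E) x).symm) u) := by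
    filter_upwards [T] with u hu using evF_rep v hf hg hu
  have eD : ∀ f : M → ℝ, ContMDiff 𝓘(ℝ, E) 𝓘(ℝ, ℝ) ∞ f → (lieD X f ∘ (extChartAt 𝓘(ℝ, E) x).symm) =ᶠ[𝓝 y]
      fun u => fderiv ℝ (f ∘ (extChartAt 𝓘(ℝ, E) x).symm) u (vecRep X x u) := fun f hf => by
    filter_upwards [T] with u hu using lieD_rep X hf hu
  have dd : ∀ f : M → ℝ, ContMDiff 𝓘(ℝ, E) 𝓘(ℝ, ℝ) ∞ f →
     DifferentiableAt ℝ (fderiv ℝ (f ∘ (extChartAt 𝓘(ℝ, E) x).symm)) y := fun f hf =>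
    (((rep_smooth hf x).fderiv_of_isOpen (isOpen_tgt x) (m := ∞) (by simp)).contDiffAt T).differentiableAt (by simp)
  have dB : DifferentiableAt ℝ (bivRep v x) y := ((hv.2 x).contDiffAt T).differentiableAt (by simp)
  have dX := diffAt_vecRep X x
  have dL : ∀ f : M → ℝ, ContMDiff 𝓘(ℝ, E) 𝓘(ℝ, ℝ) ∞ f → dAt (E := E) (lieD X f) x =
     (fderiv ℝ (f ∘ (extChartAt 𝓘(ℝ, E) x).symm) y).comp (fderiv ℝ (vecRep X x) y) +
      (fderiv ℝ (fderiv ℝ (f ∘ (extChartAt 𝓘(ℝ, E) x).symm)) y) (vecRep X x y) := fun f hf => by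
    rw [dAt_self (lieD_smooth X hf), (eD f hf).fderiv_eq, fderiv_clm_apply (dd f hf) dX]
    congr 1
    ext w
    have hs : IsSymmSndFDerivAt ℝ (f ∘ (extChartAt 𝓘(ℝ, E) x).symm) y :=
      ((rep_smooth hf x).contDiffAt T).isSymmSndFDerivAt (by simpa using two_le)
    rw [ContinuousLinearMap.flip_apply]
    exact hs w (vecRep X x y)
  have d1 := DifferentiableAt.clm_apply dB (dd f hf)
  rw [e1.fderiv_eq, fderiv_clm_apply d1 (dd g hg), fderiv_clm_apply dB (dd f hf)]
  unfold evF
  rw [dL f hf, dL g hg, dAt_self hf, dAt_self hg]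
  unfold schouten
  rw [← hy, bivRep_self]
  simp only [add_apply, sub_apply, ContinuousLinearMap.comp_apply,
    ContinuousLinearMap.flip_apply, ContinuousLinearMap.bilinearComp_apply, map_add,
    ContinuousLinearMap.id_apply, precomp_apply]
  ring

lemma biv_skew {v : M → BivectorAt E} (hv : v ∈ bivectorFields E M) (x : M) (ξ η : E →L[ℝ] ℝ) : v x ξ η = - v x η ξ := by
  have h := hv.1 x (ξ + η)
  simp only [map_add, add_apply, hv.1, zero_add, add_zero] at h
  linarith

lemma evF_add_left (v : M → BivectorAt E) {f f' : M → ℝ} (hf : ContMDiff 𝓘(ℝ, E) 𝓘(ℝ, ℝ) ∞ f)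
    (hf' : ContMDiff 𝓘(ℝ, E) 𝓘(ℝ, ℝ) ∞ f') (g : M → ℝ) :
    evF v (f + f') g = evF v f g + evF v f' g := by
  funext x; unfold evF; rw [dAt_add hf hf', map_add]; rfl

lemma evF_smul_left (v : M → BivectorAt E) {f : M → ℝ} (hf : ContMDiff 𝓘(ℝ, E) 𝓘(ℝ, ℝ) ∞ f) (c : ℝ)
    (g : M → ℝ) : evF v (c • f) g = c • evF v f g := by
  funext x; unfold evF; rw [dAt_smul hf, map_smul]; rfl

lemma evF_add_right (v : M → BivectorAt E) {f f' : M → ℝ} (hf : ContMDiff 𝓘(ℝ, E) 𝓘(ℝ, ℝ) ∞ f)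
    (hf' : ContMDiff 𝓘(ℝ, E) 𝓘(ℝ, ℝ) ∞ f') (g : M → ℝ) :
    evF v g (f + f') = evF v g f + evF v g f' := by
  funext x; unfold evF; rw [dAt_add hf hf', map_add]; rfl

lemma evF_smul_right (v : M → BivectorAt E) {f : M → ℝ} (hf : ContMDiff 𝓘(ℝ, E) 𝓘(ℝ, ℝ) ∞ f) (c : ℝ)
    (g : M → ℝ) : evF v g (c • f) = c • evF v g f := by
  funext x; unfold evF; rw [dAt_smul hf, map_smul]; rfl

lemma evF_sub_left (v : M → BivectorAt E) {f f' : M → ℝ} (hf : ContMDiff 𝓘(ℝ, E) 𝓘(ℝ, ℝ) ∞ f)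
    (hf' : ContMDiff 𝓘(ℝ, E) 𝓘(ℝ, ℝ) ∞ f') (g : M → ℝ) :
    evF v (f - f') g = evF v f g - evF v f' g := by
  have := evF_add_left v (hf.sub hf') hf' g
  have h : (fun x => f x - f' x) + f' = f := by ext; simp
  rw [h] at this
  rw [this]; exact (add_sub_cancel_right _ _).symm

lemma evF_sub_right (v : M → BivectorAt E) {f f' : M → ℝ} (hf : ContMDiff 𝓘(ℝ, E) 𝓘(ℝ, ℝ) ∞ f)
    (hf' : ContMDiff 𝓘(ℝ, E) 𝓘(ℝ, ℝ) ∞ f') (g : M → ℝ) :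
    evF v g (f - f') = evF v g f - evF v g f' := by
  have := evF_add_right v (hf.sub hf') hf' g
  have h : (fun x => f x - f' x) + f' = f := by ext; simp
  rw [h] at this
  rw [this]; exact (add_sub_cancel_right _ _).symm

section
variable [T2Space M]

lemma schouten_mem (X : VF E M) {v : M → BivectorAt E} (hv : v ∈ bivectorFields E M) : schouten X v ∈ bivectorFields E M := by
  constructor
  · intro x ξ
    obtain ⟨f, hf, hf'⟩ := exists_dAt x ξ
    have h := evF_schouten X hv hf hf x
    have h0 : evF v f f = fun _ => (0 : ℝ) := funext fun y => hv.1 y _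
    have h1 : evF v f (lieD X f) x = - evF v (lieD X f) f x := biv_skew hv x _ _
    rw [h1, h0] at h
    have h2 : lieD X (fun _ : M => (0 : ℝ)) x = 0 := by
      have := lieD_smul X (contMDiff_const (I := 𝓘(ℝ, E)) (I' := 𝓘(ℝ, ℝ)) (n := ∞) (M := M) (c := (0 : ℝ))) 0 x
      rw [zero_mul] at this
      rwa [zero_smul] at this
    rw [h2] at h
    rw [← hf']
    refine Eq.trans h (by ring)
  · refine biv_smooth fun f g hf hg => ?_
    rw [show evF (schouten X v) f g = fun x => lieD X (evF v f g) x - evF v (lieD X f) g x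
      - evF v f (lieD X g) x from funext fun x => evF_schouten X hv hf hg x]
    exact ((lieD_smooth X (evF_smooth hv hf hg)).sub (evF_smooth hv (lieD_smooth X hf) hg)).sub
      (evF_smooth hv hf (lieD_smooth X hg))

lemma schouten_add_left (X Y : VF E M) {v : M → BivectorAt E} (hv : v ∈ bivectorFields E M) :
    schouten (X + Y) v = schouten X v + schouten Y v := by
  refine biv_ext fun f g hf hg x => ?_
  have e : ∀ f, lieD (X + Y) f = lieD X f + lieD Y f := fun f => funext fun y => lieD_VF_add X Y f y
  change _ = evF (schouten X v) f g x + evF (schouten Y v) f g x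
  rw [evF_schouten _ hv hf hg, evF_schouten _ hv hf hg, evF_schouten _ hv hf hg, e, e, e,
    evF_add_left _ (lieD_smooth _ hf) (lieD_smooth _ hf),
    evF_add_right _ (lieD_smooth _ hg) (lieD_smooth _ hg)]
  simp only [Pi.add_apply]; ring

lemma schouten_smul_left (c : ℝ) (X : VF E M) {v : M → BivectorAt E} (hv : v ∈ bivectorFields E M) :
    schouten (c • X) v = c • schouten X v := by
  refine biv_ext fun f g hf hg x => ?_
  have e : ∀ f, lieD (c • X) f = c • lieD X f := fun f => funext fun y => lieD_VF_smul c X f y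
  change _ = c * evF (schouten X v) f g x
  rw [evF_schouten _ hv hf hg, evF_schouten _ hv hf hg, e, e, e,
    evF_smul_left _ (lieD_smooth _ hf),
    evF_smul_right _ (lieD_smooth _ hg)]
  simp only [Pi.smul_apply, smul_eq_mul]; ring

lemma schouten_add_right (X : VF E M) {v w : M → BivectorAt E} (hv : v ∈ bivectorFields E M) (hw : w ∈ bivectorFields E M) :
    schouten X (v + w) = schouten X v + schouten X w := by
  refine biv_ext fun f g hf hg x => ?_
  have e : ∀ f g, evF (v + w) f g = evF v f g + evF w f g := fun f g => rfl
  change _ = evF (schouten X v) f g x + evF (schouten X w) f g x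
  rw [evF_schouten _ ((bivectorFields E M).add_mem hv hw) hf hg, evF_schouten _ hv hf hg, evF_schouten _ hw hf hg, e, e, e,
    lieD_add _ (evF_smooth hv hf hg) (evF_smooth hw hf hg)]
  simp only [Pi.add_apply]; ring

lemma schouten_smul_right (c : ℝ) (X : VF E M) {v : M → BivectorAt E} (hv : v ∈ bivectorFields E M) :
    schouten X (c • v) = c • schouten X v := by
  refine biv_ext fun f g hf hg x => ?_
  have e : ∀ v : M → BivectorAt E, ∀ f g, evF (c • v) f g = c • evF v f g := fun v f g => rfl
  change _ = c * evF (schouten X v) f g x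
  rw [evF_schouten _ ((bivectorFields E M).smul_mem c hv) hf hg, evF_schouten _ hv hf hg, e, e, e,
    lieD_smul _ (evF_smooth hv hf hg)]
  simp only [Pi.smul_apply, smul_eq_mul]; ring

lemma schouten_jacobi (A B : VF E M) {v : M → BivectorAt E} (hv : v ∈ bivectorFields E M) :
    schouten (bracket A B) v = schouten A (schouten B v) - schouten B (schouten A v) := by
  refine biv_ext fun f g hf hg x => ?_
  have hA := schouten_mem A hv
  have hB := schouten_mem B hv
  change _ = evF (schouten A (schouten B v)) f g x - evF (schouten B (schouten A v)) f g x
  have e : ∀ f, ContMDiff 𝓘(ℝ, E) 𝓘(ℝ, ℝ) ∞ f → lieD (bracket A B) f = lieD A (lieD B f) - lieD B (lieD A f) :=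
    fun f hf => funext fun y => lieD_bracket A B hf y
  have k : ∀ (X : VF E M) (f g : M → ℝ), ContMDiff 𝓘(ℝ, E) 𝓘(ℝ, ℝ) ∞ f → ContMDiff 𝓘(ℝ, E) 𝓘(ℝ, ℝ) ∞ g →
     evF (schouten X v) f g = lieD X (evF v f g) - evF v (lieD X f) g - evF v f (lieD X g) :=
    fun X f g hf hg => funext fun x => evF_schouten X hv hf hg x
  have S := fun (X : VF E M) (f : M → ℝ) (hf : ContMDiff 𝓘(ℝ, E) 𝓘(ℝ, ℝ) ∞ f) => lieD_smooth X hf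
  have Q := fun (f g : M → ℝ) (hf : ContMDiff 𝓘(ℝ, E) 𝓘(ℝ, ℝ) ∞ f) (hg : ContMDiff 𝓘(ℝ, E) 𝓘(ℝ, ℝ) ∞ g) =>
    evF_smooth hv hf hg
  have L : ∀ X Y : VF E M, lieD X (lieD Y (evF v f g) - evF v (lieD Y f) g - evF v f (lieD Y g)) x =
      lieD X (lieD Y (evF v f g)) x - lieD X (evF v (lieD Y f) g) x - lieD X (evF v f (lieD Y g)) x :=
    fun X Y => by
      have s1 : ContMDiff 𝓘(ℝ, E) 𝓘(ℝ, ℝ) ∞ (lieD Y (evF v f g) - evF v (lieD Y f) g) :=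
        (S _ _ (Q _ _ hf hg)).sub (Q _ _ (S _ _ hf) hg)
      rw [lieD_sub _ s1 (Q _ _ hf (S _ _ hg)), lieD_sub _ (S _ _ (Q _ _ hf hg)) (Q _ _ (S _ _ hf) hg)]
  rw [evF_schouten _ hv hf hg, evF_schouten _ hB hf hg, evF_schouten _ hA hf hg, k _ _ _ hf hg, k _ _ _ hf hg,
    k _ _ _ (S _ _ hf) hg, k _ _ _ (S _ _ hf) hg, k _ _ _ hf (S _ _ hg), k _ _ _ hf (S _ _ hg),
    e f hf, e g hg, lieD_bracket _ _ (Q _ _ hf hg), L, L,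
    evF_sub_left _ (S _ _ (S _ _ hf)) (S _ _ (S _ _ hf)),
    evF_sub_right _ (S _ _ (S _ _ hg)) (S _ _ (S _ _ hg))]
  simp only [Pi.sub_apply]
  ring
end

variable (E) in
/-- The basis of the dual space that is dual to the chosen basis of `E`. -/
def dualBasis (i : Fin (Module.finrank ℝ E)) : E →L[ℝ] ℝ :=
  LinearMap.toContinuousLinearMap ((Module.finBasis ℝ E).coord i)

/-- The contraction `ι_v a = ½ ∑ v(eⁱ, eʲ) a(e_i, e_j, …)` of a form with a bivector, in the convention
`ι_{X ∧ Y} a = ι_Y ι_X a = a(X, Y, …)`. It does not depend on the basis `e`. -/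
def contract {k : ℕ} (v : BivectorAt E) (a : E [⋀^Fin (k + 2)]→L[ℝ] ℝ) : E [⋀^Fin k]→L[ℝ] ℝ :=
  (1 / 2 : ℝ) • ∑ i, ∑ j, v (dualBasis E i) (dualBasis E j) •
    (a.curryLeft (Module.finBasis ℝ E i)).curryLeft (Module.finBasis ℝ E j)

lemma contract_apply {k : ℕ} (v : BivectorAt E) (a : E [⋀^Fin (k + 2)]→L[ℝ] ℝ) (w : Fin k → E) :
    contract v a w = (1 / 2 : ℝ) * ∑ i, ∑ j, v (dualBasis E i) (dualBasis E j) *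
      a (Matrix.vecCons (Module.finBasis ℝ E i) (Matrix.vecCons (Module.finBasis ℝ E j) w)) := by
  unfold contract
  rw [ContinuousAlternatingMap.smul_apply, ContinuousAlternatingMap.sum_apply]
  simp only [ContinuousAlternatingMap.sum_apply]
  rfl

lemma dual_comp (A : E →L[ℝ] E) (i : Fin (Module.finrank ℝ E)) :
    (dualBasis E i).comp A = ∑ j, (dualBasis E i (A (Module.finBasis ℝ E j))) • dualBasis E j := by
  ext w
  have h := congrArg (fun w => dualBasis E i (A w)) ((Module.finBasis ℝ E).sum_repr w)
  simp only [map_sum, map_smul] at h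
  simp only [ContinuousLinearMap.comp_apply, sum_apply, smul_apply]
  rw [← h]
  exact Finset.sum_congr rfl fun j _ => mul_comm _ _

lemma sum_dual (A : E →L[ℝ] E) (w : E) :
    ∑ i, (dualBasis E i (A w)) • Module.finBasis ℝ E i = A w :=
  (Module.finBasis ℝ E).sum_repr (A w)

lemma tr_swap (A : E →L[ℝ] E) (p : (E →L[ℝ] ℝ) →ₗ[ℝ] E →ₗ[ℝ] ℝ) :
    ∑ i, p ((dualBasis E i).comp A) (Module.finBasis ℝ E i) =
    ∑ i, p (dualBasis E i) (A (Module.finBasis ℝ E i)) := by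
  simp only [dual_comp, map_sum, map_smul, LinearMap.sum_apply, LinearMap.smul_apply]
  rw [Finset.sum_comm]
  refine Finset.sum_congr rfl fun i _ => ?_
  conv_rhs => rw [← sum_dual A]
  simp only [map_sum, map_smul]

/-- An auxiliary bilinear pairing, in the first arguments. -/
def pair1 {k : ℕ} (v : BivectorAt E) (a : E [⋀^Fin (k + 2)]→L[ℝ] ℝ) (w : Fin k → E) (η : E →L[ℝ] ℝ) (f : E) :
   (E →L[ℝ] ℝ) →ₗ[ℝ] E →ₗ[ℝ] ℝ := LinearMap.mk₂ ℝ
    (fun ξ e => v ξ η * a (Matrix.vecCons e (Matrix.vecCons f w)))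
    (fun ξ ξ' e => by simp [add_mul]) (fun c ξ e => by simp [mul_assoc])
    (fun ξ e e' => by rw [alt_cons_add]; ring) (fun c ξ e => by rw [alt_cons_smul, smul_eq_mul]; ring)

/-- An auxiliary bilinear pairing, in the second arguments. -/
def pair2 {k : ℕ} (v : BivectorAt E) (a : E [⋀^Fin (k + 2)]→L[ℝ] ℝ) (w : Fin k → E) (η : E →L[ℝ] ℝ) (f : E) :
   (E →L[ℝ] ℝ) →ₗ[ℝ] E →ₗ[ℝ] ℝ := LinearMap.mk₂ ℝ
    (fun ξ e => v η ξ * a (Matrix.vecCons f (Matrix.vecCons e w)))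
    (fun ξ ξ' e => by simp [add_mul]) (fun c ξ e => by simp [mul_assoc])
    (fun ξ e e' => by
      have := alt_cons_add (a.curryLeft f) e e' w
      change a (Matrix.vecCons f (Matrix.vecCons (e + e') w)) = a (Matrix.vecCons f (Matrix.vecCons e w)) +
        a (Matrix.vecCons f (Matrix.vecCons e' w)) at this
      rw [this]; ring) (fun c ξ e => by
      have := alt_cons_smul (a.curryLeft f) c e w
      change a (Matrix.vecCons f (Matrix.vecCons (c • e) w)) = c * a (Matrix.vecCons f (Matrix.vecCons e w)) at this
      rw [this, smul_eq_mul]; ring)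

lemma tr1 {k : ℕ} (A B C : E →L[ℝ] E) (v : BivectorAt E) (a : E [⋀^Fin (k + 2)]→L[ℝ] ℝ) (w : Fin k → E) :
    ∑ i, ∑ j, v ((dualBasis E i).comp A) ((dualBasis E j).comp B) *
      a (Matrix.vecCons (Module.finBasis ℝ E i) (Matrix.vecCons (C (Module.finBasis ℝ E j)) w)) =
    ∑ i, ∑ j, v (dualBasis E i) ((dualBasis E j).comp B) *
      a (Matrix.vecCons (A (Module.finBasis ℝ E i)) (Matrix.vecCons (C (Module.finBasis ℝ E j)) w)) := by
  rw [Finset.sum_comm, Finset.sum_comm (f := fun i j => v (dualBasis E i) ((dualBasis E j).comp B) * _)]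
  exact Finset.sum_congr rfl fun j _ => tr_swap A (pair1 v a w _ _)

lemma tr2 {k : ℕ} (A B C : E →L[ℝ] E) (v : BivectorAt E) (a : E [⋀^Fin (k + 2)]→L[ℝ] ℝ) (w : Fin k → E) :
    ∑ i, ∑ j, v ((dualBasis E i).comp B) ((dualBasis E j).comp A) *
      a (Matrix.vecCons (C (Module.finBasis ℝ E i)) (Matrix.vecCons (Module.finBasis ℝ E j) w)) =
    ∑ i, ∑ j, v ((dualBasis E i).comp B) (dualBasis E j) *
      a (Matrix.vecCons (C (Module.finBasis ℝ E i)) (Matrix.vecCons (A (Module.finBasis ℝ E j)) w)) :=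
  Finset.sum_congr rfl fun _ _ => tr_swap A (pair2 v a w _ _)

lemma comp_id' (ξ : E →L[ℝ] ℝ) : ξ.comp (.id ℝ E) = ξ := by ext; rfl

lemma contract_pull {k : ℕ} (A B : E →L[ℝ] E) (h : ∀ w, B (A w) = w) (v : BivectorAt E) (a : E [⋀^Fin (k + 2)]→L[ℝ] ℝ) (w : Fin k → E) :
    contract (v.bilinearComp (precomp A) (precomp A)) (a.compContinuousLinearMap B) w = contract v a (B ∘ w) := by
  rw [contract_apply, contract_apply]
  congr 1
  have e : ∀ x y : E, (a.compContinuousLinearMap B) (Matrix.vecCons x (Matrix.vecCons y w)) =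
     a (Matrix.vecCons (B x) (Matrix.vecCons (B y) (B ∘ w))) := fun x y => by
    change a _ = a _
    congr 1
    ext i
    refine Fin.cases rfl (fun i => Fin.cases rfl (fun i => rfl) i) i
  have t1 := tr1 A A (.id ℝ E) v (a.compContinuousLinearMap B) w
  have t2 := tr2 A (.id ℝ E) A v (a.compContinuousLinearMap B) w
  simp only [comp_id', ContinuousLinearMap.id_apply] at t1 t2
  refine t1.trans (t2.trans ?_)
  simp only [e, h]

/-- The contraction `ι_v a` of a differential form with a bivector field. -/
def iotaB {k : ℕ} (v : M → BivectorAt E) (a : M → E [⋀^Fin (k + 2)]→L[ℝ] ℝ) (x : M) : E [⋀^Fin k]→L[ℝ] ℝ :=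
  contract (v x) (a x)

lemma altRep_iotaB {k : ℕ} (v : M → BivectorAt E) (a : M → E [⋀^Fin (k + 2)]→L[ℝ] ℝ) {x₀ : M} {u : E}
    (hu : u ∈ (extChartAt 𝓘(ℝ, E) x₀).target) :
    altRep (iotaB v a) x₀ u = contract (bivRep v x₀ u) (altRep a x₀ u) := by
  ext w
  refine (contract_pull _ _ ?_ _ _ w).symm
  exact dChartSymm_comp hu

lemma iotaB_mem {k : ℕ} {v : M → BivectorAt E} (hv : v ∈ bivectorFields E M) {a : M → E [⋀^Fin (k + 2)]→L[ℝ] ℝ}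
    (ha : a ∈ Form E M (k + 2)) : iotaB v a ∈ Form E M k := by
  intro x₀
  refine ContDiffOn.congr ?_ (fun u hu => altRep_iotaB v a hu)
  refine ContDiffOn.const_smul _ (ContDiffOn.sum fun i _ => ContDiffOn.sum fun j _ => ?_)
  refine ContDiffOn.smul (((hv.2 x₀).clm_apply contDiffOn_const).clm_apply contDiffOn_const) ?_
  exact ((curryCLM (E := E) k).contDiff.comp_contDiffOn
    (((curryCLM (E := E) (k + 1)).contDiff.comp_contDiffOn (ha x₀)).clm_apply contDiffOn_const)).clm_apply contDiffOn_const

section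
variable [T2Space M]

lemma exists_constVF (x : M) (e : E) : ∃ X : VF E M, vecRep X x =ᶠ[𝓝 (extChartAt 𝓘(ℝ, E) x x)] fun _ => e := by
  obtain ⟨ψ, h1, h2, h3⟩ := exists_bump (E := E) x ((isOpen_extChartAt_source (I := 𝓘(ℝ, E)) x).mem_nhds
    (mem_extChartAt_source x))
  let Y : (y : M) → TangentSpace 𝓘(ℝ, E) y := VectorField.mpullback 𝓘(ℝ, E) 𝓘(ℝ, E) (extChartAt 𝓘(ℝ, E) x) (fun _ => e)
  have hY : CMDiff[(extChartAt 𝓘(ℝ, E) x).source] ∞ (T% Y) := by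
    intro y hy
    apply ContMDiffAt.contMDiffWithinAt
    refine ContMDiffAt.mpullback_vectorField_preimage (n := ∞) ?_ ?_ (isInvertible_mfderiv_extChartAt hy) (by simp)
    · exact contMDiffAt_vectorSpace_iff_contDiffAt.2 contDiffAt_const
    · exact contMDiffOn_extChartAt.contMDiffAt ((chartAt E x).open_source.mem_nhds (by simpa using hy))
  refine ⟨⟨ψ • Y, ContMDiffOn.smul_section_of_tsupport h1.contMDiffOn (isOpen_extChartAt_source x) h3 hY⟩, ?_⟩
  have h4 := (continuousAt_extChartAt_symm'' (I := 𝓘(ℝ, E)) (mem_extChartAt_target (I := 𝓘(ℝ, E)) x))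
  rw [ContinuousAt, extChartAt_to_inv] at h4
  filter_upwards [h4.eventually h2, tgt_nhds x] with u hu hu'
  set y := (extChartAt 𝓘(ℝ, E) x).symm u with hy
  change dChart x y (ψ y • (dChart x y).inverse e) = e
  have h5 : ψ y = 1 := hu
  rw [h5, one_smul]
  have h6 : (dChart x y).inverse = dChartSymm x u := by
    apply ContinuousLinearMap.inverse_eq
    · ext v; exact dChart_comp_symm hu' v
    · ext v; exact dChartSymm_comp hu' v
  rw [h6]; exact dChart_comp_symm hu' e

lemma lieD_iotaB {Ω : M → E [⋀^Fin 3]→L[ℝ] ℝ} (hΩ : Ω ∈ Form E M 3) (hd : ∀ x, extD Ω x = 0)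
    {α : M → E [⋀^Fin 1]→L[ℝ] ℝ} (hα : α ∈ Form E M 1) {X : VF E M}
    (h : IsHamiltonianFor Ω α X) {v : M → BivectorAt E} (hv : v ∈ bivectorFields E M) (W : VF E M) (x : M) :
    lieD X (ev1 (iotaB v Ω) W) x = ev1 (iotaB (schouten X v) Ω) W x + ev1 (iotaB v Ω) (bracket X W) x := by
  set y := extChartAt 𝓘(ℝ, E) x x with hy
  choose A hA using fun i => exists_constVF x (Module.finBasis ℝ E i)
  have hAx : ∀ i, A i x = Module.finBasis ℝ E i := fun i => by
    rw [← vecRep_self]; exact (hA i).self_of_nhds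
  have T := tgt_nhds (E := E) x
  have dX := diffAt_vecRep X x
  set D : E →L[ℝ] E := fderiv ℝ (vecRep X x) y with hD
  have hbr : ∀ i, bracket X (A i) x = - D (Module.finBasis ℝ E i) := fun i => by
    rw [bracket_self_pt]
    unfold VectorField.lieBracket
    rw [← hy, (hA i).fderiv_eq, (hA i).self_of_nhds]
    simp only [hD, fderiv_fun_const, Pi.zero_apply, zero_apply, zero_sub]
    rfl
  have sm : ∀ A B C : VF E M, ContMDiff 𝓘(ℝ, E) 𝓘(ℝ, ℝ) ∞ (ev3 Ω A B C) := ev3_smooth hΩ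
  have e1 : (ev1 (iotaB v Ω) W ∘ (extChartAt 𝓘(ℝ, E) x).symm) =ᶠ[𝓝 y] fun u =>
     (1 / 2 : ℝ) * ∑ i, ∑ j, bivRep v x u (dualBasis E i) (dualBasis E j) *
      (ev3 Ω (A i) (A j) W ∘ (extChartAt 𝓘(ℝ, E) x).symm) u := by
    filter_upwards [T, Filter.eventually_all.2 hA] with u hu hA
    have h1 := altRep_apply (iotaB v Ω) x hu ![W]
    have h2 : ev1 (iotaB v Ω) W ((extChartAt 𝓘(ℝ, E) x).symm u) = altRep (iotaB v Ω) x u ![vecRep W x u] := by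
      rw [vec1 (E := E) (fun i => vecRep (![W] i) x u)] at h1
      refine Eq.trans ?_ h1.symm
      exact congrArg (iotaB v Ω ((extChartAt 𝓘(ℝ, E) x).symm u)) (vec1 (E := E)
        (fun i => (![W] i) ((extChartAt 𝓘(ℝ, E) x).symm u))).symm
    rw [Function.comp_apply, h2, altRep_iotaB v Ω hu, contract_apply]
    congr 1
    refine Finset.sum_congr rfl fun i _ => Finset.sum_congr rfl fun j _ => ?_
    congr 1
    have h3 := altRep_apply Ω x hu ![A i, A j, W]
    rw [vec3 (E := E) (fun l => vecRep (![A i, A j, W] l) x u)] at h3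
    rw [← hA i, ← hA j]
    refine h3.trans ?_
    exact congrArg (Ω ((extChartAt 𝓘(ℝ, E) x).symm u)) (vec3 (E := E) _)
  have dB : DifferentiableAt ℝ (bivRep v x) y := ((hv.2 x).contDiffAt T).differentiableAt (by simp)
  have s1 : ContMDiff 𝓘(ℝ, E) 𝓘(ℝ, ℝ) ∞ (ev1 (iotaB v Ω) W) := ev1_smooth (iotaB_mem hv hΩ) W
  rw [lieD_self X s1, e1.fderiv_eq, ← vecRep_self X x]
  have d3 : ∀ i j, HasFDerivAt (ev3 Ω (A i) (A j) W ∘ (extChartAt 𝓘(ℝ, E) x).symm)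
     (fderiv ℝ (ev3 Ω (A i) (A j) W ∘ (extChartAt 𝓘(ℝ, E) x).symm) y) y := fun i j =>
    (diffAt_rep (sm _ _ _) x).hasFDerivAt
  have d4 : ∀ i j, HasFDerivAt (fun u => bivRep v x u (dualBasis E i) (dualBasis E j))
      (((fderiv ℝ (bivRep v x) y).flip (dualBasis E i)).flip (dualBasis E j)) y := fun i j => by
    have := (dB.hasFDerivAt.clm_apply (hasFDerivAt_const (dualBasis E i) y)).clm_apply
       (hasFDerivAt_const (dualBasis E j) y)
    refine this.congr_fderiv ?_
    ext w; simp
  have d5 := (HasFDerivAt.fun_sum fun i (_ : i ∈ Finset.univ) => HasFDerivAt.fun_sum fun j (_ : j ∈ Finset.univ) =>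
     (d4 i j).mul (d3 i j)).const_mul (1 / 2 : ℝ)
  refine (congrArg (fun L : E →L[ℝ] ℝ => L (vecRep X x y)) d5.fderiv).trans ?_
  have p : ∀ i j, fderiv ℝ (ev3 Ω (A i) (A j) W ∘ (extChartAt 𝓘(ℝ, E) x).symm) y (vecRep X x y) =
     - Ω x ![D (Module.finBasis ℝ E i), Module.finBasis ℝ E j, W x]
     - Ω x ![Module.finBasis ℝ E i, D (Module.finBasis ℝ E j), W x] +
      Ω x ![Module.finBasis ℝ E i, Module.finBasis ℝ E j, bracket X W x] := fun i j => by
    rw [vecRep_self, ← lieD_self X (sm _ _ _), lieD_ev3_of_ham hΩ hd hα h]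
    have z1 : ev3 Ω (bracket X (A i)) (A j) W x =
       - Ω x ![D (Module.finBasis ℝ E i), Module.finBasis ℝ E j, W x] := by
      refine Eq.trans ?_ (alt_cons_neg (Ω x) (D (Module.finBasis ℝ E i)) ![Module.finBasis ℝ E j, W x])
      exact congrArg₂ (fun a b : E => Ω x ![a, b, W x]) (hbr i) (hAx j)
    have z2 : ev3 Ω (A i) (bracket X (A j)) W x =
       - Ω x ![Module.finBasis ℝ E i, D (Module.finBasis ℝ E j), W x] := by
      refine Eq.trans ?_ (alt_cons_neg ((Ω x).curryLeft (Module.finBasis ℝ E i))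
        (D (Module.finBasis ℝ E j)) ![W x])
      exact congrArg₂ (fun a b : E => Ω x ![a, b, W x]) (hAx i) (hbr j)
    have z3 : ev3 Ω (A i) (A j) (bracket X W) x =
       Ω x ![Module.finBasis ℝ E i, Module.finBasis ℝ E j, bracket X W x] :=
      congrArg₂ (fun a b : E => Ω x ![a, b, bracket X W x]) (hAx i) (hAx j)
    rw [z1, z2, z3]; ring
  have q1 : ∀ i j, (ev3 Ω (A i) (A j) W ∘ (extChartAt 𝓘(ℝ, E) x).symm) y =
     Ω x ![Module.finBasis ℝ E i, Module.finBasis ℝ E j, W x] := fun i j => by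
    rw [Function.comp_apply, hy, extChartAt_to_inv]
    exact congrArg₂ (fun a b : E => Ω x ![a, b, W x]) (hAx i) (hAx j)
  have sc : ∀ ξ η : E →L[ℝ] ℝ, schouten X v x ξ η = fderiv ℝ (bivRep v x) y (vecRep X x y) ξ η
      - v x (ξ.comp D) η - v x ξ (η.comp D) := fun ξ η => by
    unfold schouten
    rw [bivRep_self]; rfl
  have t1 := tr1 D (.id ℝ E) (.id ℝ E) (v x) (Ω x) ![W x]
  have t2 := tr2 D (.id ℝ E) (.id ℝ E) (v x) (Ω x) ![W x]
  simp only [comp_id', ContinuousLinearMap.id_apply] at t1 t2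
  have c1 := contract_apply (schouten X v x) (Ω x) ![W x]
  have c2 := contract_apply (v x) (Ω x) ![bracket X W x]
  simp only [sc, sub_mul, Finset.sum_sub_distrib] at c1
  rw [t1, t2] at c1
  refine Eq.trans ?_ (congrArg₂ (· + ·) c1 c2).symm
  simp only [smul_apply, sum_apply, add_apply, p, q1, ContinuousLinearMap.flip_apply, smul_eq_mul,
    bivRep_self, ← hy]
  rw [← mul_add]
  congr 1
  simp only [mul_add, mul_sub, mul_neg, Finset.sum_add_distrib, Finset.sum_sub_distrib, Finset.sum_neg_distrib]
  simp only [mul_comm (Ω x _)]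
  have bs : bivRep v x y = v x := bivRep_self v x
  rw [bs]
  ring
end

/-- A Lie 2-algebra over `ℝ`, concentrated in the degrees `-1` (the space `L₁`) and `0` (the space
`L₀`). The mixed bracket is `l2m a x = l₂(a, x)`, and `l₂(x, a)` stands for `-l₂(a, x)`. -/
structure Lie2Algebra (L₁ L₀ : Type*) [AddCommGroup L₁] [Module ℝ L₁] [AddCommGroup L₀]
    [Module ℝ L₀] where
  l1 : L₁ →ₗ[ℝ] L₀
  l2 : L₀ →ₗ[ℝ] L₀ →ₗ[ℝ] L₀
  l2m : L₁ →ₗ[ℝ] L₀ →ₗ[ℝ] L₁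
  l3 : L₀ →ₗ[ℝ] L₀ →ₗ[ℝ] L₀ →ₗ[ℝ] L₁
  l2_self : ∀ x, l2 x x = 0
  l3_self_left : ∀ x y, l3 x x y = 0
  l3_self_right : ∀ x y, l3 x y y = 0
  rel2 : ∀ a x, l1 (-l2m a x) = l2 x (l1 a)
  rel3 : ∀ a b, -l2m b (l1 a) = l2m a (l1 b)
  rel4 : ∀ x y z, l1 (l3 x y z) = -l2 (l2 x y) z - l2 (l2 y z) x - l2 (l2 z x) y
  rel5 : ∀ a x y, l3 (l1 a) x y = l2m a (l2 x y) + l2m (l2m a y) x - l2m (l2m a x) y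
  rel6 : ∀ x y z t,
    l3 (l2 x y) z t - l3 (l2 x z) y t + l3 (l2 x t) y z + l3 (l2 y z) x t - l3 (l2 y t) x z
        + l3 (l2 z t) x y
      = l2m (l3 x y z) t - l2m (l3 x y t) z + l2m (l3 x z t) y - l2m (l3 y z t) x

section
variable {L₁ L₀ L₁' L₀' L₁'' L₀'' : Type*} [AddCommGroup L₁] [Module ℝ L₁] [AddCommGroup L₀]
  [Module ℝ L₀] [AddCommGroup L₁'] [Module ℝ L₁'] [AddCommGroup L₀'] [Module ℝ L₀']
  [AddCommGroup L₁''] [Module ℝ L₁''] [AddCommGroup L₀''] [Module ℝ L₀'']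

/-- The degree `0` part is a Lie algebra under `l₂`: the Jacobi identity holds. -/
def Lie2Algebra.ZeroIsLie (L : Lie2Algebra L₁ L₀) : Prop :=
  ∀ x y z, L.l2 (L.l2 x y) z + L.l2 (L.l2 y z) x + L.l2 (L.l2 z x) y = 0

/-- A morphism of Lie 2-algebras, with components `F10`, `F1m` in the degrees `0`, `-1` and `F2`. -/
@[ext]
structure Lie2Hom (L : Lie2Algebra L₁ L₀) (L' : Lie2Algebra L₁' L₀') where
  F10 : L₀ →ₗ[ℝ] L₀'
  F1m : L₁ →ₗ[ℝ] L₁'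
  F2 : L₀ →ₗ[ℝ] L₀ →ₗ[ℝ] L₁'
  F2_self : ∀ x, F2 x x = 0
  rel1 : ∀ a, L'.l1 (F1m a) = F10 (L.l1 a)
  rel2 : ∀ x y, L'.l1 (F2 x y) = F10 (L.l2 x y) - L'.l2 (F10 x) (F10 y)
  rel3 : ∀ a x, F1m (L.l2m a x) = F2 (L.l1 a) x + L'.l2m (F1m a) (F10 x)
  rel4 : ∀ x y z,
    F1m (L.l3 x y z) + (F2 (L.l2 x y) z + F2 (L.l2 y z) x + F2 (L.l2 z x) y)
      = L'.l3 (F10 x) (F10 y) (F10 z)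
        + (-L'.l2m (F2 y z) (F10 x) - L'.l2m (F2 z x) (F10 y) - L'.l2m (F2 x y) (F10 z))

lemma Lie2Algebra.l2_skew (L : Lie2Algebra L₁ L₀) (x y : L₀) : L.l2 x y = -L.l2 y x := by
  have h := L.l2_self (x + y)
  simp only [map_add, LinearMap.add_apply, L.l2_self, zero_add, add_zero] at h
  exact eq_neg_of_add_eq_zero_right h

lemma Lie2Hom.F2_skew {L : Lie2Algebra L₁ L₀} {L' : Lie2Algebra L₁' L₀'} (F : Lie2Hom L L')
    (x y : L₀) : F.F2 x y = -F.F2 y x := by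
  have h := F.F2_self (x + y)
  simp only [map_add, LinearMap.add_apply, F.F2_self, zero_add, add_zero] at h
  exact eq_neg_of_add_eq_zero_right h

/-- The composition `G ∘ F`, with `(G ∘ F)₂ = G₂ ∘ (F₁₀ × F₁₀) + G₁₋₁ ∘ F₂`. -/
def Lie2Hom.comp {L : Lie2Algebra L₁ L₀} {L' : Lie2Algebra L₁' L₀'} {L'' : Lie2Algebra L₁'' L₀''}
    (G : Lie2Hom L' L'') (F : Lie2Hom L L') : Lie2Hom L L'' where
  F10 := G.F10 ∘ₗ F.F10
  F1m := G.F1m ∘ₗ F.F1m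
  F2 := G.F2.compl₁₂ F.F10 F.F10 + F.F2.compr₂ G.F1m
  F2_self x := by simp [F.F2_self, G.F2_self]
  rel1 a := by simp [F.rel1, G.rel1]
  rel2 x y := by
    simp only [LinearMap.add_apply, LinearMap.compl₁₂_apply, LinearMap.compr₂_apply, map_add,
      G.rel2, G.rel1, F.rel2, LinearMap.comp_apply, map_sub]
    abel
  rel3 a x := by
    simp only [LinearMap.add_apply, LinearMap.compl₁₂_apply, LinearMap.compr₂_apply, map_add,
      G.rel3, F.rel3, F.rel1, LinearMap.comp_apply]
    abel
  rel4 x y z := by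
    have h := congrArg G.F1m (F.rel4 x y z)
    have h2 := G.rel4 (F.F10 x) (F.F10 y) (F.F10 z)
    have k : ∀ x y z, G.F2 (F.F10 (L.l2 x y)) (F.F10 z) =
      G.F2 (L'.l1 (F.F2 x y)) (F.F10 z) + G.F2 (L'.l2 (F.F10 x) (F.F10 y)) (F.F10 z) := by
      intro x y z
      rw [← LinearMap.add_apply, ← map_add, F.rel2, sub_add_cancel]
    simp only [map_add, map_sub, map_neg, G.rel3] at h
    simp only [LinearMap.add_apply, LinearMap.compl₁₂_apply, LinearMap.compr₂_apply, map_add,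
      LinearMap.comp_apply, k]
    have e := congrArg₂ (· + ·) h h2
    rw [← sub_eq_zero] at e ⊢
    rw [← e]
    abel
end

variable (E M) in
/-- The space of smooth bivector fields on `M`. -/
def BivectorField : Type _ := bivectorFields E M

instance : AddCommGroup (BivectorField E M) := Submodule.addCommGroup (bivectorFields E M)
instance : Module ℝ (BivectorField E M) := Submodule.module (bivectorFields E M)

section
variable [T2Space M]

variable (E M) in
/-- The Schouten bracket `(X, v) ↦ [X, v]` as a bilinear map. -/
def schoutenMap : VF E M →ₗ[ℝ] BivectorField E M →ₗ[ℝ] BivectorField E M :=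
  LinearMap.mk₂ ℝ (fun Z v => ⟨schouten Z v.1, schouten_mem Z v.2⟩)
    (fun Z W v => Subtype.ext (schouten_add_left Z W v.2))
    (fun c Z v => Subtype.ext (schouten_smul_left c Z v.2))
    (fun Z v v' => Subtype.ext (schouten_add_right Z v.2 v'.2))
    (fun c Z v => Subtype.ext (schouten_smul_right c Z v.2))

variable (E M) in
/-- The Lie bracket of vector fields as a bilinear map. -/
def bracketMap : VF E M →ₗ[ℝ] VF E M →ₗ[ℝ] VF E M :=
  LinearMap.mk₂ ℝ bracket bracket_add_left bracket_smul_left bracket_add_right bracket_smul_right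

lemma schoutenMap_jacobi (X Y : VF E M) (v : BivectorField E M) :
    schoutenMap E M (bracket X Y) v =
      schoutenMap E M X (schoutenMap E M Y v) - schoutenMap E M Y (schoutenMap E M X v) :=
  Subtype.ext (schouten_jacobi X Y v.2)

variable (E M) in
/-- The Lie 2-algebra of bivector fields and vector fields, where `l₁ = 0`, `l₃ = 0` and `l₂` is the
Schouten bracket, with `l₂(v, X) = -[X, v]` in mixed degrees. -/
def multivectorAlgebra : Lie2Algebra (BivectorField E M) (VF E M) where
  l1 := 0
  l2 := bracketMap E M
  l2m := -(schoutenMap E M).flip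
  l3 := 0
  l2_self := bracket_self
  l3_self_left _ _ := rfl
  l3_self_right _ _ := rfl
  rel2 a x := by
    simp only [LinearMap.zero_apply, map_zero]
  rel3 a b := by
    simp only [LinearMap.zero_apply, map_zero, neg_zero]
  rel4 x y z := by
    change 0 = -bracket (bracket x y) z - bracket (bracket y z) x - bracket (bracket z x) y
    rw [bracket_swap (bracket y z) x, bracket_jacobi x y z, bracket_swap z x, bracket_neg_left,
      bracket_swap y (bracket x z)]
    abel
  rel5 a x y := by
    change 0 = -schoutenMap E M (bracket x y) a + -schoutenMap E M x (-schoutenMap E M y a)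
      - -schoutenMap E M y (-schoutenMap E M x a)
    rw [schoutenMap_jacobi, map_neg, map_neg]
    abel
  rel6 x y z t := by
    simp only [LinearMap.zero_apply, map_zero, add_zero, sub_zero]
end

/-- Smooth real-valued functions on `M`. -/
abbrev SmoothFn (E : Type*) [NormedAddCommGroup E] [NormedSpace ℝ E] (M : Type*) [TopologicalSpace M]
  [ChartedSpace E M] := C^∞⟮𝓘(ℝ, E), M; 𝓘(ℝ, ℝ), ℝ⟯

variable (E M) in
/-- A 2-plectic form on `M`: a closed and nondegenerate `3`-form. -/
structure TwoPlecticForm where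
  form : M → E [⋀^Fin 3]→L[ℝ] ℝ
  smooth : form ∈ Form E M 3
  closed : ∀ x, extD form x = 0
  nondegenerate : ∀ (x : M) (v : E), (form x).curryLeft v = 0 → v = 0

variable (w : TwoPlecticForm E M)

lemma ham_unique {α : M → E [⋀^Fin 1]→L[ℝ] ℝ} {X Y : VF E M} (hX : IsHamiltonianFor w.form α X)
    (hY : IsHamiltonianFor w.form α Y) : X = Y := by
  ext x
  have h : (w.form x).curryLeft (X x : E) = (w.form x).curryLeft (Y x : E) :=
    neg_injective ((hX x).symm.trans (hY x))
  have h2 : (w.form x).curryLeft ((X x : E) - (Y x : E)) = 0 :=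
    ((curryCLM (E := E) 2 (w.form x)).map_sub (X x : E) (Y x : E)).trans (sub_eq_zero.2 h)
  exact sub_eq_zero.1 (w.nondegenerate x _ h2)

lemma iota_add {k : ℕ} (X Y : VF E M) (a : M → E [⋀^Fin (k + 1)]→L[ℝ] ℝ) (x : M) :
    iota (X + Y) a x = iota X a x + iota Y a x :=
  (curryCLM (E := E) k (a x)).map_add (X x : E) (Y x : E)

lemma iota_smul {k : ℕ} (c : ℝ) (X : VF E M) (a : M → E [⋀^Fin (k + 1)]→L[ℝ] ℝ) (x : M) :
    iota (c • X) a x = c • iota X a x :=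
  (curryCLM (E := E) k (a x)).map_smul c (X x : E)

lemma iota_zero {k : ℕ} (a : M → E [⋀^Fin (k + 1)]→L[ℝ] ℝ) (x : M) :
    iota (0 : VF E M) a x = 0 :=
  (curryCLM (E := E) k (a x)).map_zero

lemma iota_form_add {k : ℕ} (X : VF E M) (a b : M → E [⋀^Fin (k + 1)]→L[ℝ] ℝ) :
    iota X (a + b) = iota X a + iota X b := rfl

/-- Hamiltonian `1`-forms. -/
def HamForm : Submodule ℝ (M → E [⋀^Fin 1]→L[ℝ] ℝ) where
  carrier := {α | α ∈ Form E M 1 ∧ ∃ X : VF E M, IsHamiltonianFor w.form α X}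
  add_mem' := by
    rintro α β ⟨hα, X, hX⟩ ⟨hβ, Y, hY⟩
    refine ⟨(Form E M 1).add_mem hα hβ, X + Y, fun x => ?_⟩
    rw [extD_add hα hβ, iota_add, hX, hY, neg_add]
  zero_mem' := ⟨(Form E M 1).zero_mem, 0, fun x => by
    rw [iota_zero, neg_zero]
    simpa using extD_smul (0 : ℝ) (0 : M → E [⋀^Fin 1]→L[ℝ] ℝ) x⟩
  smul_mem' := by
    rintro c α ⟨hα, X, hX⟩
    refine ⟨(Form E M 1).smul_mem c hα, c • X, fun x => ?_⟩
    rw [extD_smul, iota_smul, hX, smul_neg]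

lemma HamForm.mem_form (α : HamForm w) : (α : M → E [⋀^Fin 1]→L[ℝ] ℝ) ∈ Form E M 1 := α.2.1

/-- The Hamiltonian vector field `X_α` of a Hamiltonian `1`-form, unique by nondegeneracy. -/
def hamVF : HamForm w →ₗ[ℝ] VF E M where
  toFun α := α.2.2.choose
  map_add' α β := by
    refine ham_unique w (α + β).2.2.choose_spec fun x => ?_
    refine (extD_add α.2.1 β.2.1 x).trans ?_
    rw [α.2.2.choose_spec x, β.2.2.choose_spec x, iota_add, neg_add]
  map_smul' c α := by
    refine ham_unique w (c • α).2.2.choose_spec fun x => ?_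
    refine (extD_smul c (α : M → E [⋀^Fin 1]→L[ℝ] ℝ) x).trans ?_
    rw [α.2.2.choose_spec x, RingHom.id_apply, iota_smul, smul_neg]

lemma hamVF_spec (α : HamForm w) : IsHamiltonianFor w.form α (hamVF w α) := α.2.2.choose_spec

lemma hamVF_eq (α : HamForm w) {X : VF E M} (h : IsHamiltonianFor w.form α X) : hamVF w α = X :=
  ham_unique w (hamVF_spec w α) h

section
variable [T2Space M]

/-- The differential, from functions to Hamiltonian `1`-forms. -/
def diff : SmoothFn E M →ₗ[ℝ] HamForm w where
  toFun f := ⟨dFun f, dFun_mem f.contMDiff, 0, fun x => by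
    rw [extD_dFun f.contMDiff, iota_zero, neg_zero]⟩
  map_add' f g := Subtype.ext (dFun_add f.contMDiff g.contMDiff)
  map_smul' c f := Subtype.ext (dFun_smul f.contMDiff c)

lemma hamVF_diff (f : SmoothFn E M) : hamVF w (diff w f) = 0 :=
  hamVF_eq w _ fun x => by
    change extD (dFun f) x = _
    rw [extD_dFun f.contMDiff, iota_zero, neg_zero]

/-- The bracket `(α, β) ↦ ι_{X_α ∧ X_β} ω = ι_{X_β} ι_{X_α} ω` of Hamiltonian `1`-forms. -/
def hamBracket : HamForm w →ₗ[ℝ] HamForm w →ₗ[ℝ] HamForm w :=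
  LinearMap.mk₂ ℝ (fun α β => ⟨iota (hamVF w β) (iota (hamVF w α) w.form),
      iota_mem _ (iota_mem _ w.smooth), bracket (hamVF w α) (hamVF w β),
      isHamiltonianFor_bracket w.smooth w.closed α.2.1 β.2.1 (hamVF_spec w α) (hamVF_spec w β)⟩)
    (fun α β γ => Subtype.ext (by
      funext x
      change iota _ (iota (hamVF w (α + β)) w.form) x =
        iota _ (iota (hamVF w α) w.form) x + iota _ (iota (hamVF w β) w.form) x
      rw [map_add, show iota (hamVF w α + hamVF w β) w.form =
        iota (hamVF w α) w.form + iota (hamVF w β) w.form from funext fun x => iota_add _ _ _ x]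
      rfl))
    (fun c α γ => Subtype.ext (by
      funext x
      change iota _ (iota (hamVF w (c • α)) w.form) x =
        c • iota _ (iota (hamVF w α) w.form) x
      rw [map_smul, show iota (c • hamVF w α) w.form =
        c • iota (hamVF w α) w.form from funext fun x => iota_smul _ _ _ x]
      rfl))
    (fun α β γ => Subtype.ext (by
      funext x
      change iota (hamVF w (β + γ)) _ x = iota (hamVF w β) _ x + iota (hamVF w γ) _ x
      rw [map_add, iota_add]))
    (fun c α β => Subtype.ext (by
      funext x
      change iota (hamVF w (c • β)) _ x = c • iota (hamVF w β) _ x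
      rw [map_smul, iota_smul]))

lemma hamVF_bracket (α β : HamForm w) :
    hamVF w (hamBracket w α β) = bracket (hamVF w α) (hamVF w β) :=
  hamVF_eq w _ (isHamiltonianFor_bracket w.smooth w.closed α.2.1 β.2.1 (hamVF_spec w α) (hamVF_spec w β))

lemma ev3_add_mid (a : M → E [⋀^Fin 3]→L[ℝ] ℝ) (A B B' C : VF E M) :
    ev3 a A (B + B') C = ev3 a A B C + ev3 a A B' C := by
  rw [ev3_swap01, ev3_add, ev3_swap01 a A B, ev3_swap01 a A B', neg_add]
lemma ev3_smul_mid (a : M → E [⋀^Fin 3]→L[ℝ] ℝ) (c : ℝ) (A B C : VF E M) :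
    ev3 a A (c • B) C = c • ev3 a A B C := by
  rw [ev3_swap01, ev3_smul, ev3_swap01 a A B, smul_neg]
lemma ev3_add_right (a : M → E [⋀^Fin 3]→L[ℝ] ℝ) (A B C C' : VF E M) :
    ev3 a A B (C + C') = ev3 a A B C + ev3 a A B C' := by
  rw [ev3_swap12, ev3_add_mid, ev3_swap12 a A B C, ev3_swap12 a A B C', neg_add]
lemma ev3_smul_right (a : M → E [⋀^Fin 3]→L[ℝ] ℝ) (c : ℝ) (A B C : VF E M) :
    ev3 a A B (c • C) = c • ev3 a A B C := by
  rw [ev3_swap12, ev3_smul_mid, ev3_swap12 a A B C, smul_neg]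

/-- The map `(α, β, γ) ↦ -ω(X_α, X_β, X_γ)` on Hamiltonian `1`-forms. -/
def hamTriple : HamForm w →ₗ[ℝ] HamForm w →ₗ[ℝ] HamForm w →ₗ[ℝ] SmoothFn E M :=
  LinearMap.mk₂ ℝ (fun α β =>
    { toFun := fun γ => ⟨fun x => -(w.form x ![hamVF w α x, hamVF w β x, hamVF w γ x]),
        (ev3_smooth w.smooth (hamVF w α) (hamVF w β) (hamVF w γ)).neg⟩
      map_add' := fun γ γ' => ContMDiffMap.ext fun x => by
        change -ev3 w.form _ _ (hamVF w (γ + γ')) x = -ev3 w.form _ _ _ x + -ev3 w.form _ _ _ x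
        rw [map_add, ev3_add_right, Pi.add_apply, neg_add]
      map_smul' := fun c γ => ContMDiffMap.ext fun x => by
        change -ev3 w.form _ _ (hamVF w (c • γ)) x = c * -ev3 w.form _ _ _ x
        rw [map_smul, ev3_smul_right, Pi.smul_apply, smul_eq_mul, mul_neg] })
    (fun α α' β => LinearMap.ext fun γ => ContMDiffMap.ext fun x => by
      change -ev3 w.form (hamVF w (α + α')) _ _ x = -ev3 w.form _ _ _ x + -ev3 w.form _ _ _ x
      rw [map_add, ev3_add, Pi.add_apply, neg_add])
    (fun c α β => LinearMap.ext fun γ => ContMDiffMap.ext fun x => by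
      change -ev3 w.form (hamVF w (c • α)) _ _ x = c * -ev3 w.form _ _ _ x
      rw [map_smul, ev3_smul, Pi.smul_apply, smul_eq_mul, mul_neg])
    (fun α β β' => LinearMap.ext fun γ => ContMDiffMap.ext fun x => by
      change -ev3 w.form _ (hamVF w (β + β')) _ x = -ev3 w.form _ _ _ x + -ev3 w.form _ _ _ x
      rw [map_add, ev3_add_mid, Pi.add_apply, neg_add])
    (fun c α β => LinearMap.ext fun γ => ContMDiffMap.ext fun x => by
      change -ev3 w.form _ (hamVF w (c • β)) _ x = c * -ev3 w.form _ _ _ x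
      rw [map_smul, ev3_smul_mid, Pi.smul_apply, smul_eq_mul, mul_neg])

lemma hamTriple_apply (α β γ : HamForm w) (x : M) :
    hamTriple w α β γ x = -ev3 w.form (hamVF w α) (hamVF w β) (hamVF w γ) x := rfl

lemma hamBracket_self (α : HamForm w) : hamBracket w α α = 0 :=
  Subtype.ext (funext fun x => ext1 (x := x) fun A => congrFun (ev3_self w.form (hamVF w α) A) x)

lemma hamTriple_self_left (α β : HamForm w) : hamTriple w α α β = 0 :=
  ContMDiffMap.ext fun x => by
    rw [hamTriple_apply, ev3_self]; simp

lemma hamTriple_self_right (α β : HamForm w) : hamTriple w α β β = 0 :=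
  ContMDiffMap.ext fun x => by
    rw [hamTriple_apply, ev3_rot, ev3_self]; simp

lemma hamBracket_diff (α : HamForm w) (f : SmoothFn E M) : hamBracket w α (diff w f) = 0 :=
  Subtype.ext (funext fun x => by
    change iota (hamVF w (diff w f)) _ x = 0
    rw [hamVF_diff, iota_zero])

lemma hamTriple_diff (f : SmoothFn E M) (α β : HamForm w) : hamTriple w (diff w f) α β = 0 :=
  ContMDiffMap.ext fun x => by
    rw [hamTriple_apply, hamVF_diff]
    have := congrFun (ev3_smul w.form 0 0 (hamVF w α) (hamVF w β)) x
    rw [zero_smul, zero_smul] at this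
    rw [this]; simp

lemma diff_hamTriple (α β γ : HamForm w) : diff w (hamTriple w α β γ) =
    -hamBracket w (hamBracket w α β) γ - hamBracket w (hamBracket w β γ) α
      - hamBracket w (hamBracket w γ α) β := by
  refine Subtype.ext (funext fun x => ext1 (x := x) fun A => ?_)
  change lieD A (-ev3 w.form (hamVF w α) (hamVF w β) (hamVF w γ)) x =
    -ev3 w.form (hamVF w (hamBracket w α β)) (hamVF w γ) A x
    - ev3 w.form (hamVF w (hamBracket w β γ)) (hamVF w α) A x
    - ev3 w.form (hamVF w (hamBracket w γ α)) (hamVF w β) A x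
  rw [hamVF_bracket, hamVF_bracket, hamVF_bracket, lieD_neg _ (f := ev3 w.form _ _ _) (ev3_smooth w.smooth _ _ _),
    lieD_ev3_ham w.smooth w.closed α.2.1 β.2.1 γ.2.1 (hamVF_spec w _) (hamVF_spec w _) (hamVF_spec w _)]
  ring

lemma hamTriple_rel (x y z t : HamForm w) :
    hamTriple w (hamBracket w x y) z t - hamTriple w (hamBracket w x z) y t
      + hamTriple w (hamBracket w x t) y z + hamTriple w (hamBracket w y z) x t
      - hamTriple w (hamBracket w y t) x z + hamTriple w (hamBracket w z t) x y = 0 := by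
  refine ContMDiffMap.ext fun p => ?_
  have h := ev3_bracket_ham w.smooth w.closed x.2.1 y.2.1 z.2.1 t.2.1 (hamVF_spec w _) (hamVF_spec w _)
    (hamVF_spec w _) (hamVF_spec w _) p
  change -ev3 w.form (hamVF w (hamBracket w x y)) _ _ p
    - -ev3 w.form (hamVF w (hamBracket w x z)) _ _ p
    + -ev3 w.form (hamVF w (hamBracket w x t)) _ _ p
    + -ev3 w.form (hamVF w (hamBracket w y z)) _ _ p
    - -ev3 w.form (hamVF w (hamBracket w y t)) _ _ p
    + -ev3 w.form (hamVF w (hamBracket w z t)) _ _ p = 0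
  simp only [hamVF_bracket]
  linarith

/-- The Lie 2-algebra `L²(M, ω)` of functions and Hamiltonian `1`-forms. -/
def rogersAlgebra : Lie2Algebra (SmoothFn E M) (HamForm w) where
  l1 := diff w
  l2 := hamBracket w
  l2m := 0
  l3 := hamTriple w
  l2_self := hamBracket_self w
  l3_self_left := hamTriple_self_left w
  l3_self_right := hamTriple_self_right w
  rel2 a x := by simp [hamBracket_diff]
  rel3 a b := by simp
  rel4 := diff_hamTriple w
  rel5 a x y := by simp [hamTriple_diff]
  rel6 x y z t := by simpa using hamTriple_rel w x y z t
end

lemma contract_add {k : ℕ} (v v' : BivectorAt E) (a : E [⋀^Fin (k + 2)]→L[ℝ] ℝ) :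
    contract (v + v') a = contract v a + contract v' a := by
  ext u
  rw [ContinuousAlternatingMap.add_apply]
  simp only [contract_apply, add_apply, add_mul, Finset.sum_add_distrib, mul_add]

lemma contract_smul {k : ℕ} (c : ℝ) (v : BivectorAt E) (a : E [⋀^Fin (k + 2)]→L[ℝ] ℝ) :
    contract (c • v) a = c • contract v a := by
  ext u
  rw [ContinuousAlternatingMap.smul_apply]
  simp only [contract_apply, smul_apply, smul_eq_mul, mul_assoc, ← Finset.mul_sum]
  ring

lemma contract_zero {k : ℕ} (a : E [⋀^Fin (k + 2)]→L[ℝ] ℝ) : contract (0 : BivectorAt E) a = 0 := by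
  ext u
  simp only [contract_apply, zero_apply, zero_mul, Finset.sum_const_zero, mul_zero]
  rfl

lemma contract_neg {k : ℕ} (v : BivectorAt E) (a : E [⋀^Fin (k + 2)]→L[ℝ] ℝ) :
    contract (-v) a = -contract v a := by
  ext u
  rw [ContinuousAlternatingMap.neg_apply]
  simp only [contract_apply, neg_apply, neg_mul, Finset.sum_neg_distrib, mul_neg]

/-- Hamiltonian pairs: a function `f` and a bivector field `v` with `df = -ι_v ω`. -/
def HamPair : Submodule ℝ (SmoothFn E M × BivectorField E M) where
  carrier := {p | ∀ x, dFun (E := E) p.1 x = -iotaB p.2.1 w.form x}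
  add_mem' {p q} hp hq x := by
    have h1 := congrFun (dFun_add (E := E) p.1.contMDiff q.1.contMDiff) x
    refine h1.trans ?_
    rw [Pi.add_apply, hp x, hq x]
    exact (neg_add _ _).symm.trans (congrArg Neg.neg (contract_add (p.2.1 x) (q.2.1 x) _).symm)
  zero_mem' x := by
    have h1 := congrFun (dFun_smul (E := E) (contMDiff_const (c := (0 : ℝ))) (0 : ℝ)) x
    rw [zero_smul, zero_smul] at h1
    refine h1.trans (Eq.trans ?_ (congrArg Neg.neg (contract_zero (w.form x)).symm))
    exact neg_zero.symm
  smul_mem' c p hp x := by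
    have h1 := congrFun (dFun_smul (E := E) p.1.contMDiff c) x
    refine h1.trans ?_
    rw [Pi.smul_apply, hp x]
    exact (smul_neg _ _).trans (congrArg Neg.neg (contract_smul c (p.2.1 x) _).symm)

lemma HamPair_eq (p : HamPair w) (Z : VF E M) : ev1 (iotaB p.1.2.1 w.form) Z = - lieD Z p.1.1 := by
  funext x
  have h := congrArg (fun a : E [⋀^Fin 1]→L[ℝ] ℝ => a ![Z x]) (p.2 x)
  change lieD Z p.1.1 x = -ev1 (iotaB p.1.2.1 w.form) Z x at h
  rw [Pi.neg_apply, h, neg_neg]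

section
variable [T2Space M]

lemma hamPair_bracket {f : M → ℝ} (hf : ContMDiff 𝓘(ℝ, E) 𝓘(ℝ, ℝ) ∞ f) {v : M → BivectorAt E}
    (hv : v ∈ bivectorFields E M) (h : ∀ x, dFun (E := E) f x = -iotaB v w.form x) (α : HamForm w) (x : M) :
    dFun (E := E) (ev1 (iotaB v w.form) (hamVF w α)) x
      = iotaB (schouten (hamVF w α) v) w.form x := by
  refine ext1 (x := x) fun A => ?_
  have e : ∀ Z : VF E M, ev1 (iotaB v w.form) Z = -lieD Z f := fun Z => by
    funext x
    have h := congrArg (fun a : E [⋀^Fin 1]→L[ℝ] ℝ => a ![Z x]) (h x)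
    change lieD Z f x = -ev1 (iotaB v w.form) Z x at h
    rw [Pi.neg_apply, h, neg_neg]
  have k := lieD_iotaB w.smooth w.closed α.2.1 (hamVF_spec w α) hv A x
  change lieD A (ev1 (iotaB v w.form) (hamVF w α)) x =
    ev1 (iotaB (schouten (hamVF w α) v) w.form) A x
  rw [e, e, Pi.neg_apply, lieD_neg _ (lieD_smooth _ hf), lieD_bracket _ _ hf] at k
  rw [e, lieD_neg _ (lieD_smooth _ hf)]
  linarith

/-- The map `((f, v), α) ↦ (ι_{v ∧ X_α} ω, [v, X_α])`, where `ι_{v ∧ X} ω = ι_X ι_v ω` and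
`[v, X] = -[X, v]`. -/
def hamPairBracket : HamPair w →ₗ[ℝ] HamForm w →ₗ[ℝ] HamPair w :=
  LinearMap.mk₂ ℝ
    (fun p α => ⟨(⟨fun x => iotaB p.1.2.1 w.form x ![hamVF w α x],
        ev1_smooth (iotaB_mem p.1.2.2 w.smooth) (hamVF w α)⟩,
        (multivectorAlgebra E M).l2m p.1.2 (hamVF w α)), fun x =>
      (hamPair_bracket w p.1.1.contMDiff p.1.2.2 p.2 α x).trans (by
        change _ = -contract (-schouten (hamVF w α) p.1.2.1 x) (w.form x)
        exact (neg_eq_iff_eq_neg.2 (contract_neg (schouten (hamVF w α) p.1.2.1 x)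
          (w.form x))).symm)⟩)
    (fun p q α => Subtype.ext (Prod.ext (ContMDiffMap.ext fun x =>
      congrArg (fun a : E [⋀^Fin 1]→L[ℝ] ℝ => a ![hamVF w α x])
        (contract_add (p.1.2.1 x) (q.1.2.1 x) (w.form x)))
      (((multivectorAlgebra E M).l2m.map_add₂ p.1.2 q.1.2 (hamVF w α)))))
    (fun c p α => Subtype.ext (Prod.ext (ContMDiffMap.ext fun x =>
      congrArg (fun a : E [⋀^Fin 1]→L[ℝ] ℝ => a ![hamVF w α x])
        (contract_smul c (p.1.2.1 x) (w.form x)))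
      (((multivectorAlgebra E M).l2m.map_smul₂ c p.1.2 (hamVF w α)))))
    (fun p α β => Subtype.ext (Prod.ext (ContMDiffMap.ext fun x => by
        change ev1 (iotaB p.1.2.1 w.form) (hamVF w (α + β)) x = _
        rw [map_add, ev1_add_right]; rfl)
      (by
        change (multivectorAlgebra E M).l2m p.1.2 (hamVF w (α + β)) = _
        rw [map_add, map_add]; rfl)))
    (fun c p α => Subtype.ext (Prod.ext (ContMDiffMap.ext fun x => by
        change ev1 (iotaB p.1.2.1 w.form) (hamVF w (c • α)) x = _
        rw [map_smul]
        exact alt_cons_smul (E := E) _ c (hamVF w α x) ![])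
      (by
        change (multivectorAlgebra E M).l2m p.1.2 (hamVF w (c • α)) = _
        rw [map_smul, map_smul]; rfl)))

lemma hamPairBracket_diff (p : HamPair w) (f : SmoothFn E M) : hamPairBracket w p (diff w f) = 0 := by
  refine Subtype.ext (Prod.ext (ContMDiffMap.ext fun x => ?_) ?_)
  · change ev1 (iotaB p.1.2.1 w.form) (hamVF w (diff w f)) x = 0
    rw [hamVF_diff, HamPair_eq]
    have := lieD_VF_smul (0 : ℝ) (0 : VF E M) p.1.1 x
    rw [zero_smul, zero_mul] at this
    rw [Pi.neg_apply, this, neg_zero]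
  · change (multivectorAlgebra E M).l2m p.1.2 (hamVF w (diff w f)) = 0
    rw [hamVF_diff, map_zero]

lemma hamPairBracket_rel (p : HamPair w) (α β : HamForm w) :
    hamPairBracket w p (hamBracket w α β) + hamPairBracket w (hamPairBracket w p β) α
      - hamPairBracket w (hamPairBracket w p α) β = 0 := by
  refine Subtype.ext (Prod.ext (ContMDiffMap.ext fun x => ?_) ?_)
  · change ev1 (iotaB p.1.2.1 w.form) (hamVF w (hamBracket w α β)) x
      + ev1 (iotaB (hamPairBracket w p β).1.2.1 w.form) (hamVF w α) x
      - ev1 (iotaB (hamPairBracket w p α).1.2.1 w.form) (hamVF w β) x = 0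
    have e : ∀ α : HamForm w, ((hamPairBracket w p α).1.1 : M → ℝ) = -lieD (hamVF w α) p.1.1 :=
      fun α => HamPair_eq w p (hamVF w α)
    rw [HamPair_eq, HamPair_eq, HamPair_eq, hamVF_bracket, e, e]
    simp only [Pi.neg_apply, lieD_bracket _ _ p.1.1.contMDiff,
      lieD_neg _ (lieD_smooth _ p.1.1.contMDiff)]
    ring
  · have h := (multivectorAlgebra E M).rel5 p.1.2 (hamVF w α) (hamVF w β)
    change (multivectorAlgebra E M).l2m p.1.2 (hamVF w (hamBracket w α β))
      + (multivectorAlgebra E M).l2m ((multivectorAlgebra E M).l2m p.1.2 (hamVF w β)) (hamVF w α)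
      - (multivectorAlgebra E M).l2m ((multivectorAlgebra E M).l2m p.1.2 (hamVF w α)) (hamVF w β) = 0
    rw [hamVF_bracket]
    exact h.symm

/-- The Lie 2-algebra `D̃²(M, ω)`, with triples `(f', (f, v))` of a function and a Hamiltonian pair in
degree `-1` and Hamiltonian `1`-forms in degree `0`. Its brackets are `l₁(f', (f, v)) = df'`,
`l₂(α, β) = ι_{X_α ∧ X_β} ω`, `l₂((f', (f, v)), α) = (0, (ι_{v ∧ X_α} ω, [v, X_α]))` and
`l₃(α, β, γ) = (-ω(X_α, X_β, X_γ), (0, 0))`. -/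
def delgadoAlgebra : Lie2Algebra (SmoothFn E M × HamPair w) (HamForm w) where
  l1 := diff w ∘ₗ LinearMap.fst ℝ (SmoothFn E M) (HamPair w)
  l2 := hamBracket w
  l2m := LinearMap.mk₂ ℝ (fun p α => (0, hamPairBracket w p.2 α))
    (fun p q α => Prod.ext (add_zero _).symm (LinearMap.map_add₂ (hamPairBracket w) p.2 q.2 α))
    (fun c p α => Prod.ext (smul_zero _).symm (LinearMap.map_smul₂ (hamPairBracket w) c p.2 α))
    (fun p α β => Prod.ext (add_zero _).symm ((hamPairBracket w p.2).map_add α β))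
    (fun c p α => Prod.ext (smul_zero _).symm ((hamPairBracket w p.2).map_smul c α))
  l3 := LinearMap.mk₂ ℝ (fun α β => LinearMap.inl ℝ (SmoothFn E M) (HamPair w) ∘ₗ hamTriple w α β)
    (fun α α' β => by rw [map_add, LinearMap.add_apply, LinearMap.comp_add])
    (fun c α β => by rw [map_smul, LinearMap.smul_apply, LinearMap.comp_smul])
    (fun α β β' => by rw [map_add, LinearMap.comp_add])
    (fun c α β => by rw [map_smul, LinearMap.comp_smul])
  l2_self := hamBracket_self w
  l3_self_left α β := Prod.ext (hamTriple_self_left w α β) rfl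
  l3_self_right α β := Prod.ext (hamTriple_self_right w α β) rfl
  rel2 a x := by
    change diff w (-0) = hamBracket w x (diff w a.1)
    rw [hamBracket_diff, neg_zero, map_zero]
  rel3 a b := Prod.ext neg_zero (by
    change -hamPairBracket w b.2 (diff w a.1) = hamPairBracket w a.2 (diff w b.1)
    rw [hamPairBracket_diff, hamPairBracket_diff, neg_zero])
  rel4 := diff_hamTriple w
  rel5 a x y := Prod.ext
    (by
      change hamTriple w (diff w a.1) x y = 0 + 0 - 0
      rw [hamTriple_diff]; simp)
    (hamPairBracket_rel w a.2 x y).symm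
  rel6 x y z t := Prod.ext
    (by
      have h := hamTriple_rel w x y z t
      refine Eq.trans h ?_
      change (0 : SmoothFn E M) = 0 - 0 + 0 - 0
      simp)
    (by
      change (0 : HamPair w) - 0 + 0 + 0 - 0 + 0 = hamPairBracket w 0 t - hamPairBracket w 0 z
        + hamPairBracket w 0 y - hamPairBracket w 0 x
      simp)

/-- The strict morphism `I` with `I₁₀ = id` and `I₁₋₁ f' = (f', (0, 0))`. -/
def inclusion : Lie2Hom (rogersAlgebra w) (delgadoAlgebra w) where
  F10 := LinearMap.id
  F1m := LinearMap.inl ℝ (SmoothFn E M) (HamPair w)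
  F2 := 0
  F2_self _ := rfl
  rel1 _ := rfl
  rel2 x y := by
    change diff w 0 = hamBracket w x y - hamBracket w x y
    rw [sub_self, map_zero]
  rel3 f x := Prod.ext
    (by change (0 : SmoothFn E M) = 0 + 0; simp)
    (by change (0 : HamPair w) = 0 + hamPairBracket w 0 x; simp)
  rel4 x y z := by
    simp only [LinearMap.zero_apply, map_zero, neg_zero, sub_zero, add_zero]
    rfl

/-- The strict morphism `Φ` with `Φ₁₀ = id` and `Φ₁₋₁ (f', (f, v)) = f'`. -/
def projection : Lie2Hom (delgadoAlgebra w) (rogersAlgebra w) where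
  F10 := LinearMap.id
  F1m := LinearMap.fst ℝ (SmoothFn E M) (HamPair w)
  F2 := 0
  F2_self _ := rfl
  rel1 _ := rfl
  rel2 x y := by
    change diff w 0 = hamBracket w x y - hamBracket w x y
    rw [sub_self, map_zero]
  rel3 p x := by
    change (0 : SmoothFn E M) = 0 + 0
    simp
  rel4 x y z := by
    simp only [LinearMap.zero_apply, map_zero, neg_zero, sub_zero, add_zero]
    rfl

/-- The strict 2-plectic gradient `Ψ`, with `Ψ₁₀ α = X_α`, `Ψ₁₋₁ (f', (f, v)) = v` and `Ψ₂ = 0`. -/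
def strictGradient : Lie2Hom (delgadoAlgebra w) (multivectorAlgebra E M) where
  F10 := hamVF w
  F1m := LinearMap.snd ℝ (SmoothFn E M) (BivectorField E M) ∘ₗ (HamPair w).subtype ∘ₗ
    LinearMap.snd ℝ (SmoothFn E M) (HamPair w)
  F2 := 0
  F2_self _ := rfl
  rel1 p := by
    change (0 : VF E M) = hamVF w (diff w p.1)
    rw [hamVF_diff]
  rel2 x y := by
    change (0 : VF E M) = hamVF w (hamBracket w x y) - bracket (hamVF w x) (hamVF w y)
    rw [hamVF_bracket, sub_self]
  rel3 p x := by
    change (multivectorAlgebra E M).l2m p.2.1.2 (hamVF w x) =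
      0 + (multivectorAlgebra E M).l2m p.2.1.2 (hamVF w x)
    rw [zero_add]
  rel4 x y z := by
    simp only [LinearMap.zero_apply, map_zero, neg_zero, sub_zero, add_zero]
    rfl

end

/-- `ρ₀` is an infinitesimal action of `(g₀, l₂)` on `M` by Hamiltonian vector fields. -/
structure IsHamiltonianAction (w : TwoPlecticForm E M) {g₁ g₀ : Type*} [AddCommGroup g₁] [Module ℝ g₁]
    [AddCommGroup g₀] [Module ℝ g₀] (g : Lie2Algebra g₁ g₀) (ρ₀ : g₀ →ₗ[ℝ] VF E M) : Prop where
  map_bracket : ∀ x y, ρ₀ (g.l2 x y) = bracket (ρ₀ x) (ρ₀ y)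
  hamiltonian : ∀ x, ∃ α ∈ Form E M 1, IsHamiltonianFor w.form α (ρ₀ x)

/-- `μ` is a homotopy comomentum map for the infinitesimal action `ρ₀` by Hamiltonian vector fields
`v_x = ρ₀ x`: a morphism to `L²(M, ω)` with `-ι_{v_x} ω = d(μ₁₀ x)`. -/
structure IsHomotopyComomentumMap [T2Space M] (w : TwoPlecticForm E M) {g₁ g₀ : Type*} [AddCommGroup g₁] [Module ℝ g₁]
    [AddCommGroup g₀] [Module ℝ g₀] (g : Lie2Algebra g₁ g₀) (ρ₀ : g₀ →ₗ[ℝ] VF E M)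
    (μ : Lie2Hom g (rogersAlgebra w)) : Prop where
  action : IsHamiltonianAction w g ρ₀
  moment : ∀ x p, -iota (ρ₀ x) w.form p = extD (μ.F10 x : M → E [⋀^Fin 1]→L[ℝ] ℝ) p

/-- `μ` is a 2-comomentum map for the 2-action `ρ` along `Ψ`: `Ψ ∘ μ = ρ` as morphisms of Lie
2-algebras. A 2-action of `g` is a morphism from `g` to `multivectorAlgebra E M`. -/
def IsTwoComomentumMap [T2Space M] {w : TwoPlecticForm E M} {g₁ g₀ : Type*} [AddCommGroup g₁] [Module ℝ g₁]
    [AddCommGroup g₀] [Module ℝ g₀] {g : Lie2Algebra g₁ g₀}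
    (Ψ : Lie2Hom (delgadoAlgebra w) (multivectorAlgebra E M)) (ρ : Lie2Hom g (multivectorAlgebra E M))
    (μ : Lie2Hom g (delgadoAlgebra w)) : Prop := Ψ.comp μ = ρ

end

end Plectic

end

open scoped Manifold ContDiff Topology

namespace Plectic

variable {E : Type*} [NormedAddCommGroup E] [NormedSpace ℝ E] [FiniteDimensional ℝ E]
  {M : Type*} [TopologicalSpace M] [ChartedSpace E M] [IsManifold 𝓘(ℝ, E) ∞ M] [T2Space M]
  {w : TwoPlecticForm E M} {g₁ g₀ : Type*} [AddCommGroup g₁] [Module ℝ g₁] [AddCommGroup g₀]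
  [Module ℝ g₀] {g : Lie2Algebra g₁ g₀}

/-! Everything is read off from two strict composites. The first, `Ψ ∘ I` from `L²(M, ω)` to
multivector fields, sends a Hamiltonian form `α` to `X_α` and every function to the zero bivector
field, because `I` pairs a function with the trivial pair `(0, 0)` and `Ψ` keeps only the bivector
half of that pair. Hence for any morphism `μ` into `L²(M, ω)` the composite `Ψ ∘ I ∘ μ` has
components `(X_{μ₁₀(-)}, 0, 0)`: the functions produced by `μ₁₋₁` and `μ₂` are forgotten. The moment
condition says that `ρ₀ x` is a Hamiltonian vector field of `μ₁₀ x`, and nondegeneracy of `ω` allows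
only one (`hamVF_eq`). So the composite is `(ρ₀, 0, 0)`. It is a 2-action because composites of
morphisms are morphisms (`Lie2Hom.comp`), and `I ∘ μ` lies over it by construction.

In the other direction, `Φ` is the identity in degree `0`, so passing from a 2-comomentum map `μ` to
`Φ ∘ μ` does not change the 1-forms `μ₁₀ x`. The degree `0` component of `Ψ ∘ μ = ρ` reads `X_{μ₁₀
x} = ρ₁₀ x`, and the defining equation of `X_{μ₁₀ x}` (`hamVF_spec`) then becomes the moment
condition. Compatibility of `ρ₁₀` with brackets is already part of `ρ` being a morphism: its defect
is `l₁ (ρ₂ (x, y))`, and `l₁` vanishes on multivector fields.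

The geometry sits in the fact that these algebras and morphisms exist. Closedness of `ω` together
with `d² = 0` gives `L_{X_α} ω = 0` (`lieD_ev3_of_ham`). From this, `[X_α, X_β]` is the Hamiltonian
vector field of `ι_{X_α ∧ X_β} ω` (`isHamiltonianFor_bracket`, `hamVF_bracket`), which makes `Ψ`
strict in degree `0`. The Jacobi identity for Hamiltonian forms fails only by an exact form
(`lieD_ev3_ham`, `diff_hamTriple`), and exact forms have zero Hamiltonian vector field
(`hamVF_diff`); this is how a bracket with a Jacobi defect can map to the genuine Lie algebra of
vector fields. The coherence relation for `l₃` is `ev3_bracket_ham`.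

For pairs, `df = -ι_v ω` gives `ι_{v ∧ X_α} ω = -X_α f`, whose differential is `L_{X_α} ι_v ω`.
Since `L_{X_α} ω = 0`, the Lie derivative falls on `v` alone and yields `ι_{[X_α, v]} ω`
(`lieD_iotaB`, `hamPair_bracket`). So the mixed bracket of `D̃²(M, ω)` again lands in Hamiltonian
pairs, and its bivector half is the Schouten bracket that `Ψ` must preserve. -/

/-! ### From homotopy comomentum maps to 2-comomentum maps -/

/-- The moment condition says that `ρ₀ x` is the Hamiltonian vector field of `μ₁₀ x`. -/
theorem IsHomotopyComomentumMap.hamVF_comp {ρ₀ : g₀ →ₗ[ℝ] VF E M}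
    {μ : Lie2Hom g (rogersAlgebra w)} (h : IsHomotopyComomentumMap w g ρ₀ μ) :
    hamVF w ∘ₗ μ.F10 = ρ₀ :=
  -- `hamVF` is defined by choice, so the two vector fields are compared through nondegeneracy: both
  -- solve `d(μ₁₀ x) = -ι_X ω`. The moment condition is stated with its two sides in the opposite
  -- order, hence the `symm`.
  LinearMap.ext fun x => hamVF_eq w (μ.F10 x) fun p => (h.moment x p).symm

/-- A homotopy comomentum map, included in `D̃²(M, ω)`, lies over the strict 2-action
`(ρ₀, 0, 0)`. -/
theorem IsHomotopyComomentumMap.exists_isTwoComomentumMap {ρ₀ : g₀ →ₗ[ℝ] VF E M}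
    {μ : Lie2Hom g (rogersAlgebra w)} (h : IsHomotopyComomentumMap w g ρ₀ μ) :
    ∃ ρ : Lie2Hom g (multivectorAlgebra E M), ρ.F10 = ρ₀ ∧ ρ.F1m = 0 ∧ ρ.F2 = 0 ∧
      IsTwoComomentumMap (strictGradient w) ρ ((inclusion w).comp μ) := by
  -- The witness is the composite itself, not a morphism assembled from `(ρ₀, 0, 0)`. The morphism
  -- relations then come with `Lie2Hom.comp`, the lifting condition is reflexivity, and only the
  -- three components have to be identified. The component in degree `-1` vanishes by unfolding,
  -- being the bivector half of `(f', (0, 0))`.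
  refine ⟨(strictGradient w).comp ((inclusion w).comp μ), h.hamVF_comp, rfl, ?_, rfl⟩
  refine LinearMap.ext₂ fun x y => ?_
  -- The nested composition formula gives `Ψ₂(-, -) + Ψ₁₋₁(I₂(-, -) + I₁₋₁(μ₂(x, y)))`. The two
  -- explicit zeros are `Ψ₂` and `I₂`, which vanish by strictness.
  change (0 : BivectorField E M) + (strictGradient w).F1m (0 + (inclusion w).F1m (μ.F2 x y)) = 0
  rw [zero_add, zero_add]
  -- What remains is `Ψ₁₋₁(I₁₋₁(μ₂(x, y)))`, the bivector half of `(μ₂(x, y), (0, 0))`. It is zero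
  -- by definition, whatever the function `μ₂(x, y)` is.
  rfl

/-! ### From 2-comomentum maps to homotopy comomentum maps -/

/-- The degree `0` part of a 2-action preserves brackets, since `l₁ = 0` in the target. -/
theorem twoAction_map_bracket (ρ : Lie2Hom g (multivectorAlgebra E M)) (x y : g₀) :
    ρ.F10 (g.l2 x y) = bracket (ρ.F10 x) (ρ.F10 y) :=
  -- In `ρ.rel2` the left side is `l₁` applied to `ρ₂(x, y)`, which unfolds to `0` in the algebra of
  -- multivector fields. The relation therefore says that the bracket defect of `ρ₁₀` is zero.
  sub_eq_zero.1 (ρ.rel2 x y).symm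

/-- An equality of morphisms contains the equality of their degree `0` components, and `Ψ₁₀` is the
map `α ↦ X_α`. This turns the lifting condition `Ψ ∘ μ = ρ` into the moment equation. Both
assertions of the converse use it: it shows that the values of `ρ₁₀` are Hamiltonian, and it
provides the moment condition for `Φ ∘ μ`. -/
theorem IsTwoComomentumMap.isHamiltonianFor {ρ : Lie2Hom g (multivectorAlgebra E M)}
    {μ : Lie2Hom g (delgadoAlgebra w)} (h : IsTwoComomentumMap (strictGradient w) ρ μ) (x : g₀) :
    IsHamiltonianFor w.form (μ.F10 x : M → E [⋀^Fin 1]→L[ℝ] ℝ) (ρ.F10 x) := by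
  -- The lifting condition unfolds to an equality in `Lie2Hom`. Its degree `0` part is evaluated at
  -- `x`, and `(Ψ ∘ μ)₁₀ x` is `hamVF w (μ.F10 x)` by definition.
  have e : hamVF w (μ.F10 x) = ρ.F10 x := congrArg (fun F => F.F10 x) h
  exact e ▸ hamVF_spec w (μ.F10 x)

/-- The two conditions have different sources. Compatibility with brackets comes from the 2-action
`ρ` alone, while the lift `μ` is what makes the vector fields Hamiltonian, with `μ₁₀ x` as an
explicit potential for `ρ₁₀ x`. -/
theorem IsTwoComomentumMap.isHamiltonianAction {ρ : Lie2Hom g (multivectorAlgebra E M)}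
    {μ : Lie2Hom g (delgadoAlgebra w)} (h : IsTwoComomentumMap (strictGradient w) ρ μ) :
    IsHamiltonianAction w g ρ.F10 where
  map_bracket := twoAction_map_bracket ρ
  hamiltonian x := ⟨_, HamForm.mem_form w (μ.F10 x), h.isHamiltonianFor x⟩

/-- The projection to `L²(M, ω)` of a 2-comomentum map is a homotopy comomentum map. -/
theorem IsTwoComomentumMap.isHomotopyComomentumMap {ρ : Lie2Hom g (multivectorAlgebra E M)}
    {μ : Lie2Hom g (delgadoAlgebra w)} (h : IsTwoComomentumMap (strictGradient w) ρ μ) :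
    IsHomotopyComomentumMap w g ρ.F10 ((projection w).comp μ) where
  action := h.isHamiltonianAction
  -- Since `Φ₁₀` is the identity, `(Φ ∘ μ)₁₀ x` unfolds to `μ₁₀ x`, and the moment equation for `μ`
  -- serves as it stands, up to orientation. That `Φ ∘ μ` is a morphism needs no argument here, as
  -- it is built by `Lie2Hom.comp`.
  moment x p := (h.isHamiltonianFor x p).symm

end Plectic

/-- A 2-action is an element of `Lie2Hom g (multivectorAlgebra E M)`, so the assertion that `(ρ₀, 0,
0)` is one takes the form of the existence of a morphism with these components. As a morphism is
determined by its three linear maps, such a `ρ` is unique, and the statement about the lift `I ∘ μ`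
concerns exactly this triple. In the converse the morphism property of `Φ ∘ μ` is carried by its
type, and what is asserted beyond it is the action property and the moment equation. -/
theorem mainTheorem4
    {E : Type*} [NormedAddCommGroup E] [NormedSpace ℝ E] [FiniteDimensional ℝ E]
    {M : Type*} [TopologicalSpace M] [ChartedSpace E M] [IsManifold 𝓘(ℝ, E) ∞ M] [T2Space M]
    (w : Plectic.TwoPlecticForm E M)
    {g₁ g₀ : Type*} [AddCommGroup g₁] [Module ℝ g₁] [AddCommGroup g₀] [Module ℝ g₀]
    (g : Plectic.Lie2Algebra g₁ g₀) (hg : g.ZeroIsLie) :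
    (∀ (ρ₀ : g₀ →ₗ[ℝ] Plectic.VF E M) (μ : Plectic.Lie2Hom g (Plectic.rogersAlgebra w)),
      Plectic.IsHomotopyComomentumMap w g ρ₀ μ →
        ∃ ρ : Plectic.Lie2Hom g (Plectic.multivectorAlgebra E M),
          ρ.F10 = ρ₀ ∧ ρ.F1m = 0 ∧ ρ.F2 = 0 ∧
          Plectic.IsTwoComomentumMap (Plectic.strictGradient w) ρ
            ((Plectic.inclusion w).comp μ)) ∧
    (∀ (ρ : Plectic.Lie2Hom g (Plectic.multivectorAlgebra E M))
      (μ : Plectic.Lie2Hom g (Plectic.delgadoAlgebra w)),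
      ρ.F1m = 0 → ρ.F2 = 0 →
      Plectic.IsTwoComomentumMap (Plectic.strictGradient w) ρ μ →
        Plectic.IsHamiltonianAction w g ρ.F10 ∧
        Plectic.IsHomotopyComomentumMap w g ρ.F10 ((Plectic.projection w).comp μ)) := by
  exact ⟨fun _ _ h => h.exists_isTwoComomentumMap,
    fun _ _ _ _ h => ⟨h.isHamiltonianAction, h.isHomotopyComomentumMap⟩⟩
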